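/- Let $a,b,c\in\mathbb C$, where $c$ is not a nonpositive integer, $a\neq 0$ and $b\neq c$. Let $F(a,b,c;z)$ denote the Gauss hypergeometric function on $\mathbb C\setminus[1,\infty)$: the sum of the series $\sum_{n\ge 0}\frac{(a)_n(b)_n}{(c)_n\,n!}z^n$ for $|z|<1$, continued analytically to $\mathbb C\setminus[1,\infty)$. Put $$d_{2j+1}=\frac{(a+j)(c-b+j)}{(c+2j)(c+2j+1)}\quad(j\ge 0),\qquad d_{2j}=\frac{(b+j)(c-a+j)}{(c+2j-1)(c+2j)}\quad(j\ge 1),$$ so that $d_1\ne0$, and $$B(z)=\frac{-1}{4d_1}\left(\frac{F(a,b,c;-4/(z-2))}{F(a,b+1,c+1;-4/(z-2))}-1\right),\qquad z\in\mathbb C\setminus[-2,2].$$ Let $a_0=2-4d_2$, let $a_n=2-4d_{2n+1}-4d_{2n+2}$ for $n\ge 1$, and let $b_0,b_1,b_2,\dots$ be any complex numbers with $$b_k^2=16\,d_{2k+2}d_{2k+3}=16\,\frac{(a+k+1)(c-b+k+1)(b+k+1)(c-a+k+1)}{(c+2k+2)^2(c+2k+3)(c+2k+1)}\qquad(k\ge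 0).$$ Let $J$ be the bounded operator on $\ell^2$ (complex square-summable sequences indexed by $0,1,2,\dots$) given by the tridiagonal matrix with diagonal $(a_0,a_1,a_2,\dots)$ and with both off-diagonals equal to $(b_0,b_1,b_2,\dots)$. Then $B$ is meromorphic in $\mathbb C\setminus[-2,2]$. Moreover, a number $\lambda\in\mathbb C\setminus[-2,2]$ is a pole of $B$ if and only if $\lambda$ is an eigenvalue of $J$. -/

import Mathlib

namespace HypJacobi

noncomputable section

open Filter Topology

/-! ### The Gauss hypergeometric function on `ℂ ∖ [1, ∞)` -/

/-- The slit plane `ℂ ∖ [1, ∞)`. -/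
def slit : Set ℂ := (Complex.ofReal '' Set.Ici (1 : ℝ))ᶜ

/-- `f` is the analytic continuation to `ℂ ∖ [1, ∞)` of the sum of the Gauss series
`∑ (a)ₙ (b)ₙ / ((c)ₙ n!) zⁿ`, `|z| < 1`. -/
def IsGaussContinuation (a b c : ℂ) (f : ℂ → ℂ) : Prop :=
  AnalyticOnNhd ℂ f slit ∧ ∀ z : ℂ, ‖z‖ < 1 → f z = ordinaryHypergeometric a b c z

open Classical in
/-- The Gauss hypergeometric function `F(a, b, c; z)`: the sum of the series for `|z| < 1`, and the
analytic continuation of that sum to `ℂ ∖ [1, ∞)` (unique there, the slit plane being connected).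
Values on the cut `[1, ∞)` are never used. -/
def F (a b c : ℂ) : ℂ → ℂ :=
  if h : ∃ f : ℂ → ℂ, IsGaussContinuation a b c f then h.choose else 0

/-! ### The coefficients -/

/-- `dOdd a b c j` is `d_{2j+1} = (a+j)(c-b+j) / ((c+2j)(c+2j+1))`, for `j ≥ 0`. -/
def dOdd (a b c : ℂ) (j : ℕ) : ℂ :=
  ((a + j) * (c - b + j)) / ((c + 2 * j) * (c + 2 * j + 1))

/-- `dEven a b c j` is `d_{2j} = (b+j)(c-a+j) / ((c+2j-1)(c+2j))`, for `j ≥ 1`. -/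
def dEven (a b c : ℂ) (j : ℕ) : ℂ :=
  ((b + j) * (c - a + j)) / ((c + 2 * j - 1) * (c + 2 * j))

/-- The diagonal: `a₀ = 2 - 4 d₂` and `aₙ = 2 - 4 d_{2n+1} - 4 d_{2n+2}` for `n ≥ 1`. -/
def diag (a b c : ℂ) : ℕ → ℂ
  | 0 => 2 - 4 * dEven a b c 1
  | n + 1 => 2 - 4 * dOdd a b c (n + 1) - 4 * dEven a b c (n + 2)

/-- The squares of the off-diagonal entries:
`b_k² = 16 (a+k+1)(c-b+k+1)(b+k+1)(c-a+k+1) / ((c+2k+2)² (c+2k+3) (c+2k+1))`. -/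
def offDiagSq (a b c : ℂ) (k : ℕ) : ℂ :=
  16 * (((a + k + 1) * (c - b + k + 1) * (b + k + 1) * (c - a + k + 1)) /
    ((c + 2 * k + 2) ^ 2 * (c + 2 * k + 3) * (c + 2 * k + 1)))

/-- The function `B(a, b, c; z) = -1/(4 d₁) (F(a,b,c; w) / F(a,b+1,c+1; w) - 1)` with
`w = -4/(z-2)`; the map `z ↦ w` sends `ℂ ∖ [-2, 2]` into `ℂ ∖ [1, ∞)`. -/
def B (a b c : ℂ) (z : ℂ) : ℂ :=
  -1 / (4 * dOdd a b c 0) *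
    (F a b c (-4 / (z - 2)) / F a (b + 1) (c + 1) (-4 / (z - 2)) - 1)

/-! ### Jacobi operators on `ℓ²` -/

/-- The space `ℓ²` of complex square-summable sequences. -/
abbrev ell2 : Type := lp (fun _ : ℕ => ℂ) 2

/-- The action of the tridiagonal matrix with diagonal `α` and both off-diagonals `β`. -/
def jacobiAction (α β u : ℕ → ℂ) : ℕ → ℂ
  | 0 => α 0 * u 0 + β 0 * u 1
  | n + 1 => β n * u n + α (n + 1) * u (n + 1) + β (n + 1) * u (n + 2)

theorem memlp_iff {u : ℕ → ℂ} :
    Memℓp (E := fun _ : ℕ => ℂ) u 2 ↔ Summable fun n => ‖u n‖ ^ 2 := by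
  rw [memℓp_gen_iff (by norm_num)]
  norm_num

theorem memlp_mul {γ u : ℕ → ℂ} (hγ : ∃ M : ℝ, ∀ n, ‖γ n‖ ≤ M)
    (hu : Summable fun n => ‖u n‖ ^ 2) : Summable fun n => ‖γ n * u n‖ ^ 2 := by
  obtain ⟨M, hM⟩ := hγ
  refine Summable.of_nonneg_of_le (fun n => by positivity) (fun n => ?_) (hu.mul_left (M ^ 2))
  rw [norm_mul, mul_pow]
  gcongr
  exact hM n

theorem jacobiAction_mem {α β u : ℕ → ℂ} (hα : ∃ M : ℝ, ∀ n, ‖α n‖ ≤ M)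
    (hβ : ∃ M : ℝ, ∀ n, ‖β n‖ ≤ M) (hu : Memℓp (E := fun _ : ℕ => ℂ) u 2) :
    Memℓp (E := fun _ : ℕ => ℂ) (jacobiAction α β u) 2 := by
  have h0 := memlp_iff.1 hu
  have h1 := memlp_iff.2 (memlp_mul hα h0)
  have h2 := memlp_iff.2 (memlp_mul hβ ((summable_nat_add_iff 1).2 h0))
  have h3 : Memℓp (E := fun _ : ℕ => ℂ) (fun n => Nat.casesOn n 0 fun m => β m * u m) 2 :=
    memlp_iff.2 ((summable_nat_add_iff 1).1 (by simpa using memlp_mul hβ h0))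
  convert (h3.add h1).add h2 using 1
  funext n
  cases n <;> simp [jacobiAction]

/-- The bounded operator on `ℓ²` given by the tridiagonal matrix with bounded entries: diagonal `α`
and both off-diagonals `β`. -/
def jacobiOperator (α β : ℕ → ℂ) (hα : ∃ M : ℝ, ∀ n, ‖α n‖ ≤ M)
    (hβ : ∃ M : ℝ, ∀ n, ‖β n‖ ≤ M) : ell2 →L[ℂ] ell2 :=
  ContinuousLinearMap.ofSeqClosedGraph
    (g :=
      { toFun := fun u => ⟨jacobiAction α β u, jacobiAction_mem hα hβ (lp.memℓp u)⟩
        map_add' := fun u v => by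
          apply lp.ext
          funext n
          change jacobiAction α β (u + v : ell2) n = jacobiAction α β u n + jacobiAction α β v n
          cases n <;> simp [jacobiAction] <;> ring
        map_smul' := fun r u => by
          apply lp.ext
          funext n
          cases n <;> simp [jacobiAction] <;> ring })
    (by
      intro u x y hu hy
      have coord : ∀ (v : ℕ → ell2) (l : ell2), Tendsto v atTop (𝓝 l) →
          ∀ n, Tendsto (fun k => (v k : ℕ → ℂ) n) atTop (𝓝 ((l : ℕ → ℂ) n)) := by
        intro v l hv n
        rw [tendsto_iff_norm_sub_tendsto_zero] at hv ⊢
        refine squeeze_zero (fun _ => norm_nonneg _) (fun k => ?_) hv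
        simpa using lp.norm_apply_le_norm (by norm_num) (v k - l) n
      apply lp.ext
      funext n
      refine tendsto_nhds_unique (coord _ _ hy n) ?_
      have hx := coord _ _ hu
      cases n with
      | zero => exact ((hx 0).const_mul (α 0)).add ((hx 1).const_mul (β 0))
      | succ n =>
        exact (((hx n).const_mul (β n)).add ((hx (n + 1)).const_mul (α (n + 1)))).add
          ((hx (n + 2)).const_mul (β (n + 1))))

@[simp]
theorem jacobiOperator_apply (α β : ℕ → ℂ) (hα : ∃ M : ℝ, ∀ n, ‖α n‖ ≤ M)
    (hβ : ∃ M : ℝ, ∀ n, ‖β n‖ ≤ M) (u : ell2) (n : ℕ) :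
    (jacobiOperator α β hα hβ u : ℕ → ℂ) n = jacobiAction α β u n := rfl

/-! ### The Jacobi matrix of a ratio of hypergeometric functions -/

theorem bounded_of_tendsto {γ : ℕ → ℂ} {l : ℂ} (h : Tendsto γ atTop (𝓝 l)) :
    ∃ M : ℝ, ∀ n, ‖γ n‖ ≤ M := by
  obtain ⟨M, hM⟩ := h.norm.bddAbove_range
  exact ⟨M, fun n => hM ⟨n, rfl⟩⟩

theorem tendsto_ratio (p q : ℂ) :
    Tendsto (fun k : ℕ => (p + k) / (q + 2 * k)) atTop (𝓝 (1 / 2)) := by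
  simpa using tendsto_add_mul_div_add_mul_atTop_nhds p q (1 : ℂ) (two_ne_zero)

theorem tendsto_dOdd (a b c : ℂ) : Tendsto (dOdd a b c) atTop (𝓝 (1 / 2 * (1 / 2))) := by
  refine ((tendsto_ratio a c).mul (tendsto_ratio (c - b) (c + 1))).congr fun k => ?_
  rw [dOdd, div_mul_div_comm, show c + 1 + 2 * (k : ℂ) = c + 2 * k + 1 by ring]

theorem tendsto_dEven (a b c : ℂ) : Tendsto (dEven a b c) atTop (𝓝 (1 / 2 * (1 / 2))) := by
  refine ((tendsto_ratio b (c - 1)).mul (tendsto_ratio (c - a) c)).congr fun k => ?_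
  rw [dEven, div_mul_div_comm, show c - 1 + 2 * (k : ℂ) = c + 2 * k - 1 by ring]

theorem diag_bounded (a b c : ℂ) : ∃ M : ℝ, ∀ n, ‖diag a b c n‖ ≤ M := by
  refine bounded_of_tendsto (l := 2 - 4 * (1 / 2 * (1 / 2)) - 4 * (1 / 2 * (1 / 2)))
    ((tendsto_add_atTop_iff_nat 1).1 ?_)
  exact (tendsto_const_nhds.sub
    (((tendsto_add_atTop_iff_nat 1).2 (tendsto_dOdd a b c)).const_mul 4)).sub
    (((tendsto_add_atTop_iff_nat 2).2 (tendsto_dEven a b c)).const_mul 4)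

/-- `b_k² = 16 d_{2k+2} d_{2k+3}`. -/
theorem offDiagSq_eq (a b c : ℂ) (k : ℕ) :
    offDiagSq a b c k = 16 * (dEven a b c (k + 1) * dOdd a b c (k + 1)) := by
  rw [offDiagSq, dEven, dOdd, div_mul_div_comm]
  push_cast
  congr 2 <;> ring

theorem offDiag_bounded (a b c : ℂ) (β : ℕ → ℂ) (hβ : ∀ k, β k ^ 2 = offDiagSq a b c k) :
    ∃ M : ℝ, ∀ n, ‖β n‖ ≤ M := by
  obtain ⟨M, hM⟩ := bounded_of_tendsto
    ((((tendsto_add_atTop_iff_nat 1).2 (tendsto_dEven a b c)).mul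
      ((tendsto_add_atTop_iff_nat 1).2 (tendsto_dOdd a b c))).const_mul 16)
  refine ⟨M + 1, fun n => ?_⟩
  have h1 := hM n
  rw [← offDiagSq_eq, ← hβ n, norm_pow] at h1
  nlinarith [sq_nonneg (‖β n‖ - 1), norm_nonneg (β n)]

/-- The Jacobi matrix `J`, as a bounded operator on `ℓ²`, for a choice `β` of the square roots
`b_k` of `b_k²`. -/
def J (a b c : ℂ) (β : ℕ → ℂ) (hβ : ∀ k, β k ^ 2 = offDiagSq a b c k) : ell2 →L[ℂ] ell2 :=
  jacobiOperator (diag a b c) β (diag_bounded a b c) (offDiag_bounded a b c β hβ)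

/-- The set `ℂ ∖ [-2, 2]`. -/
def offInterval : Set ℂ := (Complex.ofReal '' Set.Icc (-2 : ℝ) 2)ᶜ

/-- `z₀` is a pole of the function `f`, meromorphic at `z₀`. -/
def IsPole (f : ℂ → ℂ) (z₀ : ℂ) : Prop := MeromorphicAt f z₀ ∧ meromorphicOrderAt f z₀ < 0

end

end HypJacobi

namespace HypJacobi

noncomputable section

open Filter Topology MeasureTheory

/-! ### The Gauss series -/

/-! Put w = -4/(z-2), so that z = 2 - 4/w; both conditions on z turn out to be equivalent to
F(a,b+1,c+1;w) = 0.

Poles. `B` is a quotient of functions analytic off the interval, hence meromorphic. By Gauss's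
contiguous relation, at a zero of the denominator F(a,b+1,c+1;w) the numerator equals -d₁ w
F(a+1,b+1,c+2;w). This is nonzero, since F(a,b+1,c+1) and F(a+1,b+1,c+2) solve a first order linear
system that is regular away from 0 and 1, so a common zero would force F to vanish identically
(`F_add_one_ne_zero_of_F_eq_zero`, `isPole_B_iff`).

Eigenvalues. The contiguous relations behind Gauss's continued fraction, contracted two at a time,
show that `hypSol` solves every row of (J - z)u = 0 except row 0, where the defect is (4/w)
F(a,b+1,c+1;w). The sequence lies in ℓ² (`summable_decay`), so a zero of F(a,b+1,c+1) makes it an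
eigenvector. Conversely, the Casoratian of `hypSol` and an eigenvector V is constant and tends to 0,
so the defect times V₀ is 0 (`mul_eq_zero_of_recurrence`); if the defect is nonzero then V₀ = 0, and
V = 0 follows row by row. Where some b_m vanishes the matrix splits, and the argument restarts on
the lower block, whose defect is a hypergeometric function without zeros.

Continuation and decay both come from Euler's integral rewritten in the disc variable x with w/4 =
x/(1+x)². Raising (a,b,c) to (a+k,b+k,c+2k) multiplies the integrand by the k-th power of a factor
of modulus at most 1/4, which balances the size of the Beta function and leaves decay governed by
|x|ᵏ with |x| < 1. -/

/-- `c` is an admissible lower parameter: not a nonpositive integer. -/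
def Admissible (c : ℂ) : Prop := ∀ m : ℕ, c ≠ -(m : ℂ)

theorem Admissible.add_natCast_ne_zero {c : ℂ} (hc : Admissible c) (n : ℕ) : c + n ≠ 0 :=
  fun h => hc n (eq_neg_of_add_eq_zero_left h)

theorem Admissible.ne_zero {c : ℂ} (hc : Admissible c) : c ≠ 0 := by
  simpa using hc 0

theorem Admissible.add_natCast {c : ℂ} (hc : Admissible c) (n : ℕ) : Admissible (c + n) :=
  fun m h => hc (n + m) (by push_cast; linear_combination h)

theorem Admissible.add_one {c : ℂ} (hc : Admissible c) : Admissible (c + 1) := by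
  simpa using hc.add_natCast 1

theorem Admissible.add_two {c : ℂ} (hc : Admissible c) : Admissible (c + 2) := by
  simpa using hc.add_natCast 2

theorem admissible_of_re_pos {c : ℂ} (hc : 0 < c.re) : Admissible c := by
  rintro m rfl
  simp only [Complex.neg_re, Complex.natCast_re] at hc
  have : (0 : ℝ) ≤ m := m.cast_nonneg
  linarith

/-- The coefficients of the Gauss series. -/
def gaussCoeff (a b c : ℂ) (n : ℕ) : ℂ := ordinaryHypergeometricCoefficient a b c n

theorem ascPochhammer_eval_ne_zero {c : ℂ} (hc : Admissible c) (n : ℕ) :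
    (ascPochhammer ℂ n).eval c ≠ 0 := by
  rw [Ne, ascPochhammer_eval_eq_zero_iff]
  rintro ⟨k, -, hk⟩
  exact hc k (by rw [hk, neg_neg])

theorem ascPochhammer_eval_succ_left (x : ℂ) (n : ℕ) :
    (ascPochhammer ℂ (n + 1)).eval x = x * (ascPochhammer ℂ n).eval (x + 1) := by
  simp [ascPochhammer_succ_left]

theorem mul_ascPochhammer_eval_add_one (x : ℂ) (n : ℕ) :
    x * (ascPochhammer ℂ n).eval (x + 1) = (ascPochhammer ℂ n).eval x * (x + n) := by
  rw [← ascPochhammer_eval_succ_left, ascPochhammer_succ_eval]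

@[simp]
theorem gaussCoeff_zero (a b c : ℂ) : gaussCoeff a b c 0 = 1 := by
  simp [gaussCoeff, ordinaryHypergeometricCoefficient]

theorem gaussCoeff_comm (a b c : ℂ) (n : ℕ) : gaussCoeff a b c n = gaussCoeff b a c n := by
  simp only [gaussCoeff, ordinaryHypergeometricCoefficient]
  ring

theorem gaussCoeff_succ (a b c : ℂ) (n : ℕ) :
    gaussCoeff a b c (n + 1) =
      gaussCoeff a b c n * ((a + n) / (c + n) * ((b + n) / (1 + n))) := by
  simp only [gaussCoeff, ordinaryHypergeometricCoefficient, ascPochhammer_succ_eval,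
    Nat.factorial_succ]
  push_cast
  simp only [mul_inv, div_eq_mul_inv, add_comm (n : ℂ) 1]
  ring

/-- The coefficients of `F(a+1, b, c+1)` in terms of those of `F(a, b, c)`. -/
theorem gaussCoeff_add_one_mul {c : ℂ} (hc : Admissible c) (a b : ℂ) (n : ℕ) :
    a * (c + n) * gaussCoeff (a + 1) b (c + 1) n = c * (a + n) * gaussCoeff a b c n := by
  have h1 := mul_ascPochhammer_eval_add_one a n
  have h2 := mul_ascPochhammer_eval_add_one c n
  have h3 := ascPochhammer_eval_ne_zero hc n
  have h4 := ascPochhammer_eval_ne_zero hc.add_one n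
  simp only [gaussCoeff, ordinaryHypergeometricCoefficient]
  generalize (ascPochhammer ℂ n).eval a = A at *
  generalize (ascPochhammer ℂ n).eval (a + 1) = A' at *
  generalize (ascPochhammer ℂ n).eval c = C at *
  generalize (ascPochhammer ℂ n).eval (c + 1) = C' at *
  generalize (ascPochhammer ℂ n).eval b = B at *
  generalize ((n.factorial : ℕ) : ℂ)⁻¹ = N at *
  field_simp
  linear_combination N * B * ((c + n) * C * h1 - A * (a + n) * h2)

theorem gaussCoeff_contiguous {c : ℂ} (hc : Admissible c) (a b : ℂ) (n : ℕ) :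
    gaussCoeff a b c (n + 1) = gaussCoeff a (b + 1) (c + 1) (n + 1) -
      a * (c - b) / (c * (c + 1)) * gaussCoeff (a + 1) (b + 1) (c + 2) n := by
  have h2 := mul_ascPochhammer_eval_add_one (c + 1) n
  have h3 := ascPochhammer_eval_ne_zero hc.add_one n
  have h4 := ascPochhammer_eval_ne_zero hc.add_two n
  have h5 := hc.ne_zero
  have h6 := hc.add_one.ne_zero
  have h7 := hc.add_natCast_ne_zero (n + 1)
  have h8 : (n : ℂ) + 1 ≠ 0 := n.cast_add_one_ne_zero
  have h9 : ((n.factorial : ℕ) : ℂ) ≠ 0 := Nat.cast_ne_zero.2 n.factorial_ne_zero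
  push_cast at h7
  simp only [gaussCoeff, ordinaryHypergeometricCoefficient, ascPochhammer_eval_succ_left a,
    ascPochhammer_eval_succ_left b, ascPochhammer_eval_succ_left c,
    ascPochhammer_eval_succ_left (c + 1), ascPochhammer_succ_eval n (b + 1), Nat.factorial_succ]
  push_cast
  rw [show c + 1 + 1 = c + 2 by ring] at *
  rw [show (ascPochhammer ℂ n).eval (c + 1) =
    (c + 1) * (ascPochhammer ℂ n).eval (c + 2) / (c + (n + 1)) by
      rw [h2, eq_div_iff h7]; ring]
  field_simp
  ring

theorem tendsto_gaussCoeff_ratio (a b c : ℂ) :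
    Tendsto (fun n : ℕ => (a + n) / (c + n) * ((b + n) / (1 + n))) atTop (𝓝 1) := by
  have h (x y : ℂ) : Tendsto (fun n : ℕ => (x + n) / (y + n)) atTop (𝓝 1) := by
    simpa using tendsto_add_mul_div_add_mul_atTop_nhds x y (1 : ℂ) one_ne_zero
  simpa using (h a c).mul (h b 1)

theorem summable_norm_gaussCoeff (a b c : ℂ) {r : ℝ} (hr0 : 0 ≤ r) (hr : r < 1) :
    Summable fun n => ‖gaussCoeff a b c n‖ * r ^ n := by
  obtain ⟨s, hs, hs1⟩ := exists_between hr
  have ht : Tendsto (fun n : ℕ => ‖(a + n) / (c + n) * ((b + n) / (1 + n))‖ * r) atTop (𝓝 r) := by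
    simpa using (tendsto_gaussCoeff_ratio a b c).norm.mul_const r
  refine summable_of_ratio_norm_eventually_le hs1 ?_
  filter_upwards [ht.eventually_le_const hs] with n hn
  rw [gaussCoeff_succ, norm_mul (gaussCoeff a b c n), Real.norm_of_nonneg (by positivity),
    Real.norm_of_nonneg (by positivity), pow_succ]
  calc _ = (‖(a + n) / (c + n) * ((b + n) / (1 + n))‖ * r) * (‖gaussCoeff a b c n‖ * r ^ n) := by
        ring
    _ ≤ _ := by gcongr

theorem ordinaryHypergeometric_eq_tsum_gaussCoeff (a b c z : ℂ) :
    ordinaryHypergeometric a b c z = ∑' n, gaussCoeff a b c n * z ^ n := by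
  rw [ordinaryHypergeometric_eq_tsum]
  rfl

theorem summable_gaussCoeff (a b c : ℂ) {z : ℂ} (hz : ‖z‖ < 1) :
    Summable fun n => gaussCoeff a b c n * z ^ n :=
  .of_norm (by simpa using summable_norm_gaussCoeff a b c (norm_nonneg z) hz)

theorem hasSum_gauss (a b c : ℂ) {z : ℂ} (hz : ‖z‖ < 1) :
    HasSum (fun n => gaussCoeff a b c n * z ^ n) (ordinaryHypergeometric a b c z) := by
  rw [ordinaryHypergeometric_eq_tsum_gaussCoeff]
  exact (summable_gaussCoeff a b c hz).hasSum

theorem ordinaryHypergeometric_comm (a b c : ℂ) :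
    (ordinaryHypergeometric a b c : ℂ → ℂ) = ordinaryHypergeometric b a c := by
  funext z
  simp only [ordinaryHypergeometric_eq_tsum_gaussCoeff, gaussCoeff_comm a b]

theorem norm_gaussCoeff_mul_pow_le (a b c : ℂ) {r : ℝ} (n : ℕ) {z : ℂ}
    (hz : z ∈ Metric.ball (0 : ℂ) r) :
    ‖gaussCoeff a b c n * z ^ n‖ ≤ ‖gaussCoeff a b c n‖ * r ^ n := by
  rw [norm_mul, norm_pow]
  have := (mem_ball_zero_iff.1 hz).le
  gcongr

theorem differentiableOn_gauss (a b c : ℂ) :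
    DifferentiableOn ℂ (ordinaryHypergeometric a b c) (Metric.ball (0 : ℂ) 1) := by
  intro z hz
  obtain ⟨r, hr, hr1⟩ := exists_between (mem_ball_zero_iff.1 hz)
  refine DifferentiableAt.differentiableWithinAt ?_
  have h := Complex.differentiableOn_tsum_of_summable_norm
    (summable_norm_gaussCoeff a b c ((norm_nonneg z).trans hr.le) hr1)
    (fun n => by fun_prop) Metric.isOpen_ball
    (fun n w hw => norm_gaussCoeff_mul_pow_le a b c n hw)
  rw [show (ordinaryHypergeometric a b c : ℂ → ℂ) = fun z => ∑' n, gaussCoeff a b c n * z ^ n from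
    funext (ordinaryHypergeometric_eq_tsum_gaussCoeff a b c)]
  exact h.differentiableAt (Metric.isOpen_ball.mem_nhds (mem_ball_zero_iff.2 hr))

theorem hasSum_deriv_gauss (a b c : ℂ) {z : ℂ} (hz : ‖z‖ < 1) :
    HasSum (fun n : ℕ => (n + 1) * gaussCoeff a b c (n + 1) * z ^ n)
      (deriv (ordinaryHypergeometric a b c) z) := by
  obtain ⟨r, hr, hr1⟩ := exists_between hz
  have h := Complex.hasSum_deriv_of_summable_norm
    (summable_norm_gaussCoeff a b c ((norm_nonneg z).trans hr.le) hr1)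
    (fun n => by fun_prop) Metric.isOpen_ball
    (fun n w hw => norm_gaussCoeff_mul_pow_le a b c n hw) (mem_ball_zero_iff.2 hr)
  rw [show (ordinaryHypergeometric a b c : ℂ → ℂ) = fun z => ∑' n, gaussCoeff a b c n * z ^ n from
    funext (ordinaryHypergeometric_eq_tsum_gaussCoeff a b c)]
  have h1 := (hasSum_nat_add_iff' 1).2 h
  simp only [deriv_const_mul_field', deriv_pow_field, Finset.range_one, Finset.sum_singleton,
    Nat.cast_zero, zero_mul, mul_zero, sub_zero, Nat.add_sub_cancel] at h1
  refine h1.congr_fun fun n => ?_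
  push_cast
  ring

theorem gauss_contiguous {c : ℂ} (hc : Admissible c) (a b : ℂ) {z : ℂ} (hz : ‖z‖ < 1) :
    ordinaryHypergeometric a b c z = ordinaryHypergeometric a (b + 1) (c + 1) z -
      a * (c - b) / (c * (c + 1)) * z * ordinaryHypergeometric (a + 1) (b + 1) (c + 2) z := by
  have h1 := (hasSum_nat_add_iff' 1).2 (hasSum_gauss a b c hz)
  have h2 := (hasSum_nat_add_iff' 1).2 (hasSum_gauss a (b + 1) (c + 1) hz)
  have h3 := (hasSum_gauss (a + 1) (b + 1) (c + 2) hz).mul_left (a * (c - b) / (c * (c + 1)) * z)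
  have h := h1.unique ((h2.sub h3).congr_fun fun n => by
    rw [gaussCoeff_contiguous hc]; ring)
  simp at h
  linear_combination h

/-- `(1 - z) f' = a f + (a (b - c) / c) g` for `f = F(a, b, c)`, `g = F(a+1, b, c+1)`. -/
theorem gauss_deriv_eq {c : ℂ} (hc : Admissible c) (a b : ℂ) {z : ℂ} (hz : ‖z‖ < 1) :
    (1 - z) * deriv (ordinaryHypergeometric a b c) z = a * ordinaryHypergeometric a b c z +
      a * (b - c) / c * ordinaryHypergeometric (a + 1) b (c + 1) z := by
  have h0 := hasSum_deriv_gauss a b c hz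
  have h1 : HasSum (fun n : ℕ => n * gaussCoeff a b c n * z ^ n)
      (z * deriv (ordinaryHypergeometric a b c) z) := by
    rw [← hasSum_nat_add_iff' 1]
    simpa [pow_succ, mul_comm, mul_left_comm, mul_assoc] using h0.mul_left z
  have h2 := ((hasSum_gauss a b c hz).mul_left a).add
    ((hasSum_gauss (a + 1) b (c + 1) hz).mul_left (a * (b - c) / c))
  -- Write (1 - z) f' as f' - z f' and compare coefficients of zⁿ; what remains is a multiple of
  -- `gaussCoeff_add_one_mul`.
  rw [sub_mul, one_mul]
  refine (h0.sub h1).unique (h2.congr_fun fun n => ?_)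
  have h3 := gaussCoeff_add_one_mul hc a b n
  have h4 := hc.add_natCast_ne_zero n
  have h5 := hc.ne_zero
  have h8 : 1 + (n : ℂ) ≠ 0 := by rw [add_comm]; exact n.cast_add_one_ne_zero
  rw [gaussCoeff_succ]
  field_simp
  linear_combination (1 + (n : ℂ)) * z ^ n * (c - b) * h3

/-- `z g' = c f - c g + (c / a) z f'` for `f = F(a, b, c)`, `g = F(a+1, b, c+1)`. -/
theorem gauss_deriv_add_one_eq {c : ℂ} (hc : Admissible c) {a : ℂ} (ha : a ≠ 0) (b : ℂ) {z : ℂ}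
    (hz : ‖z‖ < 1) :
    z * deriv (ordinaryHypergeometric (a + 1) b (c + 1)) z =
      c * ordinaryHypergeometric a b c z - c * ordinaryHypergeometric (a + 1) b (c + 1) z +
        c / a * (z * deriv (ordinaryHypergeometric a b c) z) := by
  have h1 (a b c : ℂ) : HasSum (fun n : ℕ => n * gaussCoeff a b c n * z ^ n)
      (z * deriv (ordinaryHypergeometric a b c) z) := by
    rw [← hasSum_nat_add_iff' 1]
    simpa [pow_succ, mul_comm, mul_left_comm, mul_assoc] using
      (hasSum_deriv_gauss a b c hz).mul_left z
  have h2 := (((hasSum_gauss a b c hz).mul_left c).sub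
    ((hasSum_gauss (a + 1) b (c + 1) hz).mul_left c)).add ((h1 a b c).mul_left (c / a))
  refine (h1 _ _ _).unique (h2.congr_fun fun n => ?_)
  have h3 := gaussCoeff_add_one_mul hc a b n
  field_simp
  linear_combination z ^ n * h3

/-! ### Euler's integral -/

/-- The weight `t^(u-1) (1-t)^(v-1)` of the Beta integral. -/
def betaWeight (u v : ℂ) (t : ℝ) : ℂ := (t : ℂ) ^ (u - 1) * (1 - (t : ℂ)) ^ (v - 1)

theorem integrableOn_betaWeight {u v : ℂ} (hu : 0 < u.re) (hv : 0 < v.re) :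
    IntegrableOn (betaWeight u v) (Set.Ioo 0 1) :=
  (intervalIntegrable_iff_integrableOn_Ioo_of_le zero_le_one).1
    (Complex.betaIntegral_convergent hu hv)

theorem betaIntegral_eq_setIntegral (u v : ℂ) :
    Complex.betaIntegral u v = ∫ t in Set.Ioo (0 : ℝ) 1, betaWeight u v t := by
  rw [Complex.betaIntegral, intervalIntegral.integral_of_le zero_le_one, integral_Ioc_eq_integral_Ioo]
  rfl

theorem betaIntegral_ne_zero {u v : ℂ} (hu : 0 < u.re) (hv : 0 < v.re) :
    Complex.betaIntegral u v ≠ 0 := by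
  intro h
  have h1 := Complex.Gamma_mul_Gamma_eq_betaIntegral hu hv
  rw [h, mul_zero] at h1
  exact mul_ne_zero (Complex.Gamma_ne_zero_of_re_pos hu) (Complex.Gamma_ne_zero_of_re_pos hv) h1

theorem betaIntegral_add_one_left {u v : ℂ} (hu : 0 < u.re) (hv : 0 < v.re) :
    Complex.betaIntegral (u + 1) v = u / (u + v) * Complex.betaIntegral u v := by
  have huv : 0 < (u + v).re := by simpa using add_pos hu hv
  have hu1 : 0 < (u + 1).re := by simpa using add_pos hu one_pos
  have h1 := Complex.Gamma_mul_Gamma_eq_betaIntegral hu hv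
  have h2 := Complex.Gamma_mul_Gamma_eq_betaIntegral hu1 hv
  have hu0 : u ≠ 0 := (admissible_of_re_pos hu).ne_zero
  have huv0 : u + v ≠ 0 := (admissible_of_re_pos huv).ne_zero
  rw [Complex.Gamma_add_one u hu0, show u + 1 + v = u + v + 1 by ring,
    Complex.Gamma_add_one _ huv0] at h2
  have h3 := Complex.Gamma_ne_zero_of_re_pos huv
  field_simp
  refine mul_left_cancel₀ h3 ?_
  linear_combination u * h1 - h2

theorem betaIntegral_add_one_right {u v : ℂ} (hu : 0 < u.re) (hv : 0 < v.re) :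
    Complex.betaIntegral u (v + 1) = v / (u + v) * Complex.betaIntegral u v := by
  rw [← Complex.betaIntegral_symm, betaIntegral_add_one_left hv hu, Complex.betaIntegral_symm,
    add_comm u v]

theorem add_natCast_re_pos {u : ℂ} (hu : 0 < u.re) (n : ℕ) : 0 < (u + n).re := by
  simpa using add_pos_of_pos_of_nonneg hu n.cast_nonneg

theorem betaIntegral_add_natCast_left {u v : ℂ} (hu : 0 < u.re) (hv : 0 < v.re) (n : ℕ) :
    Complex.betaIntegral (u + n) v = (ascPochhammer ℂ n).eval u *
      ((ascPochhammer ℂ n).eval (u + v))⁻¹ * Complex.betaIntegral u v := by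
  induction n with
  | zero => simp
  | succ n ih =>
    rw [ascPochhammer_succ_eval, ascPochhammer_succ_eval, Nat.cast_succ, ← add_assoc,
      betaIntegral_add_one_left (add_natCast_re_pos hu n) hv, ih, mul_inv,
      show u + n + v = u + v + n by ring]
    ring

/-- The binomial series is the degenerate Gauss series F(a,1,1;x): the Pochhammer symbols of the two
parameters 1 cancel. -/
theorem hasSum_one_sub_cpow (a : ℂ) {x : ℂ} (hx : ‖x‖ < 1) :
    HasSum (fun n => gaussCoeff a 1 1 n * x ^ n) ((1 - x) ^ (-a)) := by
  have h := (Complex.one_add_cpow_hasFPowerSeriesOnBall_zero (a := -a)).hasSum (y := -x)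
    (by simpa [enorm_eq_nnnorm, ← NNReal.coe_lt_one] using hx)
  rw [binomialSeries_eq_ordinaryHypergeometricSeries (b := (1 : ℂ))
    (fun k => by norm_cast), zero_add, ← sub_eq_add_neg, neg_neg] at h
  refine h.congr_fun fun n => ?_
  rw [FormalMultilinearSeries.compContinuousLinearMap_apply,
    show ((-ContinuousLinearMap.id ℂ ℂ : ℂ →L[ℂ] ℂ) ∘ fun _ : Fin n => -x) = fun _ => x by
      ext; simp, ordinaryHypergeometricSeries_apply_eq]
  rfl

theorem betaWeight_mul_pow (u v : ℂ) {t : ℝ} (ht : t ∈ Set.Ioo (0 : ℝ) 1) (n : ℕ) :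
    betaWeight u v t * (t : ℂ) ^ n = betaWeight (u + n) v t := by
  have : (t : ℂ) ≠ 0 := Complex.ofReal_ne_zero.2 ht.1.ne'
  rw [betaWeight, betaWeight, show u + n - 1 = u - 1 + n by ring, Complex.cpow_add _ _ this,
    Complex.cpow_natCast]
  ring

theorem aestronglyMeasurable_betaWeight {u v : ℂ} (hu : 0 < u.re) (hv : 0 < v.re) :
    AEStronglyMeasurable (betaWeight u v) (volume.restrict (Set.Ioo 0 1)) :=
  (integrableOn_betaWeight hu hv).aestronglyMeasurable

/-- Euler's integral representation inside the unit disc. -/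
theorem euler_integral (a : ℂ) {b v : ℂ} (hb : 0 < b.re) (hv : 0 < v.re) {w : ℂ} (hw : ‖w‖ < 1) :
    ∫ t in Set.Ioo (0 : ℝ) 1, betaWeight b v t * (1 - w * t) ^ (-a) =
      Complex.betaIntegral b v * ordinaryHypergeometric a b (b + v) w := by
  have hsum := summable_norm_gaussCoeff a 1 1 (norm_nonneg w) hw
  have h : HasSum (fun n => ∫ t in Set.Ioo (0 : ℝ) 1,
      betaWeight b v t * (gaussCoeff a 1 1 n * (w * t) ^ n))
      (∫ t in Set.Ioo (0 : ℝ) 1, betaWeight b v t * (1 - w * t) ^ (-a)) := by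
    refine hasSum_integral_of_dominated_convergence
      (fun n t => ‖betaWeight b v t‖ * (‖gaussCoeff a 1 1 n‖ * ‖w‖ ^ n))
      (fun n => (aestronglyMeasurable_betaWeight hb hv).mul (by fun_prop)) (fun n => ?_)
      (ae_of_all _ fun t => hsum.mul_left _) ?_ ?_
    · filter_upwards [ae_restrict_mem measurableSet_Ioo] with t ht
      rw [norm_mul, norm_mul, norm_pow, norm_mul, Complex.norm_of_nonneg ht.1.le]
      have : ‖w‖ * t ≤ ‖w‖ := mul_le_of_le_one_right (norm_nonneg _) ht.2.le
      have := ht.1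
      gcongr
    · simp_rw [tsum_mul_left]
      exact (integrableOn_betaWeight hb hv).norm.mul_const _
    · filter_upwards [ae_restrict_mem measurableSet_Ioo] with t ht
      refine (hasSum_one_sub_cpow a ?_).mul_left _
      rw [norm_mul, Complex.norm_of_nonneg ht.1.le]
      exact (mul_le_of_le_one_right (norm_nonneg _) ht.2.le).trans_lt hw
  -- The n-th term is a multiple of Β(b+n, v), and Β(b+n, v)/Β(b, v) = (b)ₙ/(b+v)ₙ supplies the
  -- remaining Pochhammer symbols.
  refine h.unique (((hasSum_gauss a b (b + v) hw).mul_left _).congr_fun fun n => ?_)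
  have h1 : ∫ t in Set.Ioo (0 : ℝ) 1, betaWeight b v t * (gaussCoeff a 1 1 n * (w * t) ^ n) =
      ∫ t in Set.Ioo (0 : ℝ) 1, gaussCoeff a 1 1 n * w ^ n * betaWeight (b + n) v t := by
    refine setIntegral_congr_fun measurableSet_Ioo fun t ht => ?_
    simp only [← betaWeight_mul_pow b v ht n]
    ring
  rw [h1, integral_const_mul, ← betaIntegral_eq_setIntegral, betaIntegral_add_natCast_left hb hv]
  simp only [gaussCoeff, ordinaryHypergeometricCoefficient]
  have : (ascPochhammer ℂ n).eval 1 ≠ 0 := ascPochhammer_eval_ne_zero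
    (admissible_of_re_pos (by simp)) n
  field_simp

/-! ### The conformal parameter of the slit plane -/

theorem mem_slit_iff {w : ℂ} : w ∈ slit ↔ 1 - w ∈ Complex.slitPlane := by
  rw [slit, Set.mem_compl_iff, Complex.mem_slitPlane_iff, Complex.sub_re, Complex.sub_im,
    Complex.one_re, Complex.one_im, ← not_iff_not, not_not]
  constructor
  · rintro ⟨x, hx, rfl⟩
    simpa using hx
  · intro h
    rw [not_or, not_lt, not_not] at h
    exact ⟨w.re, by simpa using h.1, Complex.ext (by simp) (by have := h.2; simp at this ⊢; exact this.symm)⟩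

theorem isOpen_slit : IsOpen slit := by
  have : slit = (fun w => 1 - w) ⁻¹' Complex.slitPlane := by
    ext w
    exact mem_slit_iff
  rw [this]
  exact Complex.isOpen_slitPlane.preimage (by fun_prop)

theorem isPreconnected_slit : IsPreconnected slit := by
  have : slit = (fun w => 1 - w) '' Complex.slitPlane := by
    ext w
    rw [mem_slit_iff]
    exact ⟨fun h => ⟨1 - w, h, by ring⟩, by rintro ⟨z, hz, rfl⟩; simpa using hz⟩
  rw [this]
  refine IsPreconnected.image ?_ _ (by fun_prop)
  exact (Complex.starConvex_one_slitPlane.isPathConnected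
    Complex.one_mem_slitPlane).isConnected.isPreconnected

theorem mem_slit_of_norm_lt_one {w : ℂ} (hw : ‖w‖ < 1) : w ∈ slit := by
  rw [mem_slit_iff, sub_eq_add_neg]
  exact Complex.mem_slitPlane_of_norm_lt_one (by simpa using hw)

theorem zero_mem_slit : (0 : ℂ) ∈ slit := mem_slit_of_norm_lt_one (by simp)

theorem one_sub_ne_zero_of_mem_slit {w : ℂ} (hw : w ∈ slit) : 1 - w ≠ 0 :=
  Complex.slitPlane_ne_zero (mem_slit_iff.1 hw)

/-- The principal branch of `√(1 - w)`. -/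
def sqrtVar (w : ℂ) : ℂ := (1 - w) ^ (1 / 2 : ℂ)

/-- The conformal map `(1 - √(1 - w)) / (1 + √(1 - w))` of the slit plane onto the unit disc. -/
def discVar (w : ℂ) : ℂ := (1 - sqrtVar w) / (1 + sqrtVar w)

theorem sqrtVar_sq (w : ℂ) : sqrtVar w ^ 2 = 1 - w := by
  rw [sqrtVar, ← Complex.cpow_nat_mul]
  norm_num

theorem sqrtVar_re_pos {w : ℂ} (hw : w ∈ slit) : 0 < (sqrtVar w).re := by
  have h := mem_slit_iff.1 hw
  have h1 := Complex.mem_slitPlane_iff_arg.1 h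
  rw [sqrtVar, Complex.cpow_def_of_ne_zero h1.2, Complex.exp_re]
  refine mul_pos (Real.exp_pos _) (Real.cos_pos_of_mem_Ioo ?_)
  have h2 : (Complex.log (1 - w) * (1 / 2)).im = Complex.arg (1 - w) / 2 := by
    rw [show (1 / 2 : ℂ) = ((1 / 2 : ℝ) : ℂ) by norm_num, Complex.im_mul_ofReal, Complex.log_im]
    ring
  rw [h2]
  have h3 := Complex.neg_pi_lt_arg (1 - w)
  have h4 := lt_of_le_of_ne (Complex.arg_le_pi (1 - w)) h1.1
  constructor <;> linarith

theorem one_add_sqrtVar_ne_zero {w : ℂ} (hw : w ∈ slit) : 1 + sqrtVar w ≠ 0 := by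
  intro h
  have h1 := congrArg Complex.re h
  have h2 := sqrtVar_re_pos hw
  simp at h1
  linarith

/-- The principal root lies in the right half-plane, which s ↦ (1-s)/(1+s) sends into the unit disc.
-/
theorem norm_discVar_lt_one {w : ℂ} (hw : w ∈ slit) : ‖discVar w‖ < 1 := by
  have h2 := sqrtVar_re_pos hw
  rw [discVar, norm_div, div_lt_one (norm_pos_iff.2 (one_add_sqrtVar_ne_zero hw)),
    ← sq_lt_sq₀ (norm_nonneg _) (norm_nonneg _), ← Complex.normSq_eq_norm_sq,
    ← Complex.normSq_eq_norm_sq, Complex.normSq_apply, Complex.normSq_apply]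
  simp
  nlinarith

theorem one_add_discVar {w : ℂ} (hw : w ∈ slit) : 1 + discVar w = 2 / (1 + sqrtVar w) := by
  have := one_add_sqrtVar_ne_zero hw
  rw [discVar]
  field_simp
  ring

theorem mem_slitPlane_one_add {x : ℂ} (hx : ‖x‖ < 1) : 1 + x ∈ Complex.slitPlane :=
  Complex.mem_slitPlane_of_norm_lt_one hx

theorem mem_slitPlane_one_sub {x : ℂ} (hx : ‖x‖ < 1) : 1 - x ∈ Complex.slitPlane := by
  rw [sub_eq_add_neg]
  exact Complex.mem_slitPlane_of_norm_lt_one (by simpa using hx)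

theorem one_add_discVar_ne_zero {w : ℂ} (hw : w ∈ slit) : 1 + discVar w ≠ 0 :=
  Complex.slitPlane_ne_zero (mem_slitPlane_one_add (norm_discVar_lt_one hw))

/-- With s = √(1-w) and x = (1-s)/(1+s), one has 1+x = 2/(1+s), so x/(1+x)² = (1-s)(1+s)/4. -/
theorem eq_discVar {w : ℂ} (hw : w ∈ slit) : w / 4 = discVar w / (1 + discVar w) ^ 2 := by
  have h1 := one_add_sqrtVar_ne_zero hw
  rw [one_add_discVar hw, discVar]
  field_simp
  linear_combination 4 * sqrtVar_sq w

theorem differentiableOn_sqrtVar : DifferentiableOn ℂ sqrtVar slit := by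
  intro w hw
  unfold sqrtVar
  exact (DifferentiableAt.cpow (by fun_prop) (by fun_prop)
    (mem_slit_iff.1 hw)).differentiableWithinAt

theorem differentiableOn_discVar : DifferentiableOn ℂ discVar slit :=
  (differentiableOn_sqrtVar.const_sub 1).div (differentiableOn_sqrtVar.const_add 1)
    fun _ hw => one_add_sqrtVar_ne_zero hw

/-! ### The Euler integral along a circular arc -/

/-- The kernel `(1 - x)^(a-c) (1 + x)^(-a)`. -/
def eulerKernel (a c x : ℂ) : ℂ := (1 - x) ^ (a - c) * (1 + x) ^ (-a)

theorem differentiableOn_eulerKernel (a c : ℂ) :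
    DifferentiableOn ℂ (eulerKernel a c) (Metric.ball 0 1) := by
  intro x hx
  have hx1 := mem_ball_zero_iff.1 hx
  exact ((DifferentiableAt.cpow (by fun_prop) (by fun_prop) (mem_slitPlane_one_sub hx1)).mul
    (DifferentiableAt.cpow (by fun_prop) (by fun_prop)
      (mem_slitPlane_one_add hx1))).differentiableWithinAt

theorem norm_one_sub_two_mul_le {t : ℝ} (ht : t ∈ Set.Ioo (0 : ℝ) 1) :
    ‖(1 - 2 * (t : ℂ))‖ ≤ 1 := by
  rw [show (1 - 2 * (t : ℂ)) = ((1 - 2 * t : ℝ) : ℂ) by push_cast; ring, Complex.norm_real,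
    Real.norm_eq_abs, abs_le]
  constructor <;> linarith [ht.1, ht.2]

theorem norm_mul_one_sub_two_mul_le (x : ℂ) {t : ℝ} (ht : t ∈ Set.Ioo (0 : ℝ) 1) :
    ‖x * (1 - 2 * (t : ℂ))‖ ≤ ‖x‖ := by
  rw [norm_mul]
  exact mul_le_of_le_one_right (norm_nonneg _) (norm_one_sub_two_mul_le ht)

theorem aestronglyMeasurable_comp_segment {k : ℂ → ℂ} (hk : ContinuousOn k (Metric.ball 0 1))
    {x : ℂ} (hx : ‖x‖ < 1) :
    AEStronglyMeasurable (fun t : ℝ => k (x * (1 - 2 * (t : ℂ))))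
      (volume.restrict (Set.Ioo 0 1)) :=
  (hk.comp (by fun_prop) fun _ ht => mem_ball_zero_iff.2
    ((norm_mul_one_sub_two_mul_le x ht).trans_lt hx)).aestronglyMeasurable measurableSet_Ioo

theorem exists_norm_le_of_norm_le {k : ℂ → ℂ} (hk : ContinuousOn k (Metric.ball 0 1)) {r : ℝ}
    (hr : r < 1) : ∃ M, ∀ y : ℂ, ‖y‖ ≤ r → ‖k y‖ ≤ M := by
  obtain ⟨M, hM⟩ := (isCompact_closedBall (0 : ℂ) r).exists_bound_of_continuousOn
    (hk.mono (Metric.closedBall_subset_ball hr))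
  exact ⟨M, fun y hy => hM y (mem_closedBall_zero_iff.2 hy)⟩

theorem integrableOn_mul_comp_segment {k : ℂ → ℂ} (hk : ContinuousOn k (Metric.ball 0 1))
    {ω : ℝ → ℂ} (hω : IntegrableOn ω (Set.Ioo 0 1)) {x : ℂ} (hx : ‖x‖ < 1) :
    IntegrableOn (fun t : ℝ => ω t * k (x * (1 - 2 * (t : ℂ)))) (Set.Ioo 0 1) := by
  obtain ⟨M, hM⟩ := exists_norm_le_of_norm_le hk hx
  refine hω.mul_bdd (c := M) (aestronglyMeasurable_comp_segment hk hx) ?_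
  filter_upwards [ae_restrict_mem measurableSet_Ioo] with t ht
  exact hM _ (norm_mul_one_sub_two_mul_le x ht)

/-- The points x(1-2t), 0 < t < 1, stay in the closed disc of radius |x|. The derivative of `k` is
therefore bounded uniformly in t for x in a smaller disc, and one may differentiate under the
integral. -/
theorem differentiableOn_integral_comp_segment {k : ℂ → ℂ}
    (hk : DifferentiableOn ℂ k (Metric.ball 0 1)) {ω : ℝ → ℂ}
    (hω : IntegrableOn ω (Set.Ioo 0 1)) :
    DifferentiableOn ℂ (fun x => ∫ t in Set.Ioo (0 : ℝ) 1, ω t * k (x * (1 - 2 * (t : ℂ))))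
      (Metric.ball 0 1) := by
  intro x hx
  obtain ⟨r, hr, hr1⟩ := exists_between (mem_ball_zero_iff.1 hx)
  have hk' : ContinuousOn (deriv k) (Metric.ball 0 1) :=
    (hk.deriv Metric.isOpen_ball).continuousOn
  obtain ⟨M, hM⟩ := exists_norm_le_of_norm_le hk' hr1
  have hnhds : Metric.ball (0 : ℂ) r ∈ 𝓝 x :=
    Metric.isOpen_ball.mem_nhds (mem_ball_zero_iff.2 hr)
  refine (_root_.hasDerivAt_integral_of_dominated_loc_of_deriv_le (𝕜 := ℂ)
    (μ := volume.restrict (Set.Ioo 0 1)) (bound := fun t => ‖ω t‖ * M)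
    (F := fun y t => ω t * k (y * (1 - 2 * (t : ℂ))))
    (F' := fun y t => ω t * (deriv k (y * (1 - 2 * (t : ℂ))) * (1 - 2 * (t : ℂ))))
    hnhds ?_ (integrableOn_mul_comp_segment hk.continuousOn hω (mem_ball_zero_iff.1 hx)) ?_ ?_
    (hω.norm.mul_const M) ?_).2.differentiableAt.differentiableWithinAt
  · filter_upwards [hnhds] with y hy
    exact (integrableOn_mul_comp_segment hk.continuousOn hω
      ((mem_ball_zero_iff.1 hy).trans hr1)).aestronglyMeasurable
  · exact hω.aestronglyMeasurable.mul ((aestronglyMeasurable_comp_segment hk'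
      (mem_ball_zero_iff.1 hx)).mul (by fun_prop))
  · filter_upwards [ae_restrict_mem measurableSet_Ioo] with t ht y hy
    rw [norm_mul, norm_mul]
    have h1 := hM _ ((norm_mul_one_sub_two_mul_le y ht).trans (mem_ball_zero_iff.1 hy).le)
    gcongr
    exact (mul_le_of_le_one_right (norm_nonneg _) (norm_one_sub_two_mul_le ht)).trans h1
  · filter_upwards [ae_restrict_mem measurableSet_Ioo] with t ht y hy
    have h1 : HasDerivAt k (deriv k (y * (1 - 2 * (t : ℂ)))) (y * (1 - 2 * (t : ℂ))) :=
      (hk.differentiableAt (Metric.isOpen_ball.mem_nhds (mem_ball_zero_iff.2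
        ((norm_mul_one_sub_two_mul_le y ht).trans_lt
          ((mem_ball_zero_iff.1 hy).trans hr1))))).hasDerivAt
    refine HasDerivAt.const_mul _ (h1.comp y ?_)
    simpa using (hasDerivAt_id y).mul_const (1 - 2 * (t : ℂ))

/-- Euler's integral in the disc variable. -/
def eulerTransform (a b c x : ℂ) : ℂ :=
  ∫ t in Set.Ioo (0 : ℝ) 1, betaWeight b (c - b) t * eulerKernel a c (x * (1 - 2 * (t : ℂ)))

/-- The continuation of the Gauss series provided by Euler's integral. -/
def eulerContinuation (a b c w : ℂ) : ℂ :=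
  sqrtVar w ^ (c - a - b) * (1 + discVar w) ^ c / Complex.betaIntegral b (c - b) *
    eulerTransform a b c (discVar w)

theorem ofReal_cpow_eq_exp {x : ℝ} (hx : 0 < x) (s : ℂ) :
    (x : ℂ) ^ s = Complex.exp ((Real.log x : ℝ) * s) := by
  rw [Complex.cpow_def_of_ne_zero (Complex.ofReal_ne_zero.2 hx.ne'), Complex.ofReal_log hx.le]

/-- The substitution `t = τ / (τ + (1 - τ) q)` in Euler's integral. -/
theorem euler_integral_substitution (a b c : ℂ) {q : ℝ} (hq : 0 < q) :
    ∫ t in Set.Ioo (0 : ℝ) 1, betaWeight b (c - b) t * (1 - (1 - (q : ℂ) ^ 2) * t) ^ (-a) =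
      (q : ℂ) ^ (c - a - b) * (1 + ((1 - q) / (1 + q) : ℝ) : ℂ) ^ c *
        eulerTransform a b c ((1 - q) / (1 + q) : ℝ) := by
  set D : ℝ → ℝ := fun τ => τ + (1 - τ) * q with hD
  have hD0 : ∀ τ ∈ Set.Ioo (0 : ℝ) 1, 0 < D τ := fun τ hτ => by
    have := mul_pos (sub_pos.2 hτ.2) hq
    have := hτ.1
    simp only [hD]; linarith
  have himg : (fun τ => τ / D τ) '' Set.Ioo (0 : ℝ) 1 = Set.Ioo 0 1 := by
    ext t
    constructor
    · rintro ⟨τ, hτ, rfl⟩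
      have h := hD0 τ hτ
      refine ⟨div_pos hτ.1 h, (div_lt_one h).2 ?_⟩
      simp only [hD]
      linarith [mul_pos (sub_pos.2 hτ.2) hq]
    · intro ht
      have h1 : 0 < 1 - t + q * t := by nlinarith [ht.1, ht.2, mul_pos hq ht.1]
      -- The witness solves τ = t (τ + (1 - τ) q) for τ.
      refine ⟨q * t / (1 - t + q * t), ⟨div_pos (mul_pos hq ht.1) h1, (div_lt_one h1).2 ?_⟩, ?_⟩
      · linarith [ht.2]
      · simp only [hD]
        have : q * t / (1 - t + q * t) + (1 - q * t / (1 - t + q * t)) * q =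
          q / (1 - t + q * t) := by field_simp; ring
        rw [this]
        field_simp
  have hinj : Set.InjOn (fun τ => τ / D τ) (Set.Ioo (0 : ℝ) 1) := by
    intro x hx y hy hxy
    simp only at hxy
    rw [div_eq_div_iff (hD0 x hx).ne' (hD0 y hy).ne'] at hxy
    simp only [hD] at hxy
    exact mul_right_cancel₀ hq.ne' (by linear_combination hxy)
  have hder : ∀ τ ∈ Set.Ioo (0 : ℝ) 1, HasDerivWithinAt (fun τ => τ / D τ) (q / D τ ^ 2)
      (Set.Ioo 0 1) τ := by
    intro τ hτ
    have h1 : HasDerivAt D (1 + (0 - 1) * q) τ :=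
      (hasDerivAt_id τ).add (((hasDerivAt_const τ (1 : ℝ)).sub (hasDerivAt_id τ)).mul_const q)
    refine (HasDerivAt.congr_deriv ((hasDerivAt_id' τ).fun_div h1 (hD0 τ hτ).ne')
      ?_).hasDerivWithinAt
    simp only [hD]
    ring
  rw [← himg, integral_image_eq_integral_abs_deriv_smul measurableSet_Ioo hder hinj,
    eulerTransform, ← integral_const_mul]
  refine setIntegral_congr_fun measurableSet_Ioo fun τ hτ => ?_
  have hDτ := hD0 τ hτ
  have hτ' : 0 < 1 - τ := sub_pos.2 hτ.2
  have hq1 : 0 < 1 + q := by linarith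
  have hE : 0 < 1 - τ + q * τ := by nlinarith [hτ.1, mul_pos hq hτ.1]
  have e1 : 1 - τ / D τ = (1 - τ) * q / D τ := by
    field_simp
    simp only [hD]
    ring
  have e2 : 1 - (1 - q ^ 2) * (τ / D τ) = q * (1 - τ + q * τ) / D τ := by
    field_simp
    simp only [hD]
    ring
  have e3 : 1 - (1 - q) / (1 + q) * (1 - 2 * τ) = 2 * D τ / (1 + q) := by
    field_simp
    simp only [hD]
    ring
  have e4 : 1 + (1 - q) / (1 + q) * (1 - 2 * τ) = 2 * (1 - τ + q * τ) / (1 + q) := by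
    field_simp
    ring
  have e5 : 1 + (1 - q) / (1 + q) = 2 / (1 + q) := by
    field_simp
    ring
  -- All bases are positive reals, so each complex power is the exponential of a real logarithm
  -- times its exponent. The integrands then agree by an identity linear in the logarithms of τ,
  -- 1-τ, q, D τ, 1-τ+qτ, 1+q and 2.
  have l1 := Real.log_div hτ.1.ne' hDτ.ne'
  have l2 := Real.log_div (mul_pos hτ' hq).ne' hDτ.ne'
  have l3 := Real.log_div (mul_pos hq hE).ne' hDτ.ne'
  have l4 := Real.log_div (mul_pos two_pos hDτ).ne' hq1.ne'
  have l5 := Real.log_div (mul_pos two_pos hE).ne' hq1.ne'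
  have l6 := Real.log_div two_ne_zero hq1.ne'
  have l7 := Real.log_div hq.ne' (pow_pos hDτ 2).ne'
  rw [Real.log_mul hτ'.ne' hq.ne'] at l2
  rw [Real.log_mul hq.ne' hE.ne'] at l3
  rw [Real.log_mul two_ne_zero hDτ.ne'] at l4
  rw [Real.log_mul two_ne_zero hE.ne'] at l5
  rw [Real.log_pow] at l7
  have hp : 0 < q / D τ ^ 2 := by positivity
  have hprod : ((q / D τ ^ 2 : ℝ) : ℂ) = Complex.exp (Real.log (q / D τ ^ 2) : ℝ) := by
    rw [← Complex.ofReal_exp, Real.exp_log hp]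
  simp only [abs_of_pos hp, Complex.real_smul, betaWeight, eulerKernel]
  rw [hprod,
    show (1 : ℂ) - ((τ / D τ : ℝ) : ℂ) = ((1 - τ / D τ : ℝ) : ℂ) by push_cast; ring,
    show (1 : ℂ) - (1 - (q : ℂ) ^ 2) * ((τ / D τ : ℝ) : ℂ) =
      ((1 - (1 - q ^ 2) * (τ / D τ) : ℝ) : ℂ) by push_cast; ring,
    show (1 : ℂ) - (((1 - q) / (1 + q) : ℝ) : ℂ) * (1 - 2 * (τ : ℂ)) =
      ((1 - (1 - q) / (1 + q) * (1 - 2 * τ) : ℝ) : ℂ) by push_cast; ring,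
    show (1 : ℂ) + (((1 - q) / (1 + q) : ℝ) : ℂ) * (1 - 2 * (τ : ℂ)) =
      ((1 + (1 - q) / (1 + q) * (1 - 2 * τ) : ℝ) : ℂ) by push_cast; ring,
    show (1 : ℂ) + (((1 - q) / (1 + q) : ℝ) : ℂ) =
      ((1 + (1 - q) / (1 + q) : ℝ) : ℂ) by push_cast; ring,
    show (1 : ℂ) - (τ : ℂ) = ((1 - τ : ℝ) : ℂ) by push_cast; ring,
    e1, e2, e3, e4, e5, ofReal_cpow_eq_exp hτ', ofReal_cpow_eq_exp hτ.1, ofReal_cpow_eq_exp hq,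
    ofReal_cpow_eq_exp (div_pos hτ.1 hDτ), ofReal_cpow_eq_exp (div_pos (mul_pos hτ' hq) hDτ),
    ofReal_cpow_eq_exp (div_pos (mul_pos hq hE) hDτ), ofReal_cpow_eq_exp (div_pos two_pos hq1),
    ofReal_cpow_eq_exp (div_pos (mul_pos two_pos hDτ) hq1),
    ofReal_cpow_eq_exp (div_pos (mul_pos two_pos hE) hq1), l1, l2, l3, l4, l5, l6, l7]
  simp only [← Complex.exp_add]
  congr 1
  push_cast
  ring

theorem sqrtVar_ofReal {x : ℝ} (hx : x < 1) : sqrtVar x = (Real.sqrt (1 - x) : ℝ) := by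
  rw [sqrtVar, Real.sqrt_eq_rpow, Complex.ofReal_cpow (by linarith)]
  push_cast
  rfl

/-- Only real x in (0,1) are treated: the substitution then stays on the real segment and no branch
of a power is in question. -/
theorem eulerContinuation_ofReal (a : ℂ) {b c : ℂ} (hb : 0 < b.re) (hcb : 0 < (c - b).re) {x : ℝ}
    (hx0 : 0 < x) (hx1 : x < 1) :
    eulerContinuation a b c x = ordinaryHypergeometric a b c (x : ℂ) := by
  have hq : 0 < Real.sqrt (1 - x) := Real.sqrt_pos.2 (by linarith)
  have h1 := euler_integral_substitution a b c hq
  have h2 := euler_integral a hb hcb (w := x) (by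
    rw [Complex.norm_of_nonneg hx0.le]; exact hx1)
  have h3 : 1 - ((Real.sqrt (1 - x) : ℝ) : ℂ) ^ 2 = x := by
    rw [← Complex.ofReal_pow, Real.sq_sqrt (by linarith)]
    push_cast
    ring
  rw [h3, h2, add_sub_cancel] at h1
  have h4 : discVar x = ((1 - Real.sqrt (1 - x)) / (1 + Real.sqrt (1 - x)) : ℝ) := by
    rw [discVar, sqrtVar_ofReal hx1]
    push_cast
    rfl
  rw [eulerContinuation, sqrtVar_ofReal hx1, h4, div_mul_eq_mul_div, ← h1,
    mul_div_cancel_left₀ _ (betaIntegral_ne_zero hb hcb)]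

theorem analyticOnNhd_eulerContinuation (a : ℂ) {b c : ℂ} (hb : 0 < b.re) (hcb : 0 < (c - b).re) :
    AnalyticOnNhd ℂ (eulerContinuation a b c) slit := by
  refine DifferentiableOn.analyticOnNhd ?_ isOpen_slit
  have h1 : DifferentiableOn ℂ (fun w => eulerTransform a b c (discVar w)) slit :=
    (differentiableOn_integral_comp_segment (differentiableOn_eulerKernel a c)
      (integrableOn_betaWeight hb hcb)).comp differentiableOn_discVar
      fun w hw => mem_ball_zero_iff.2 (norm_discVar_lt_one hw)
  refine DifferentiableOn.mul (DifferentiableOn.div_const (DifferentiableOn.mul ?_ ?_) _) h1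
  · exact differentiableOn_sqrtVar.cpow (differentiableOn_const _)
      fun w hw => Or.inl (sqrtVar_re_pos hw)
  · exact (differentiableOn_discVar.const_add 1).cpow (differentiableOn_const _)
      fun w hw => mem_slitPlane_one_add (norm_discVar_lt_one hw)

/-- Agreement on the real segment (0,1), which accumulates at 0, spreads to the disc by the identity
theorem. -/
theorem isGaussContinuation_eulerContinuation (a : ℂ) {b c : ℂ} (hb : 0 < b.re)
    (hcb : 0 < (c - b).re) : IsGaussContinuation a b c (eulerContinuation a b c) := by
  refine ⟨analyticOnNhd_eulerContinuation a hb hcb, ?_⟩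
  have h1 : AnalyticOnNhd ℂ (eulerContinuation a b c) (Metric.ball 0 1) :=
    (analyticOnNhd_eulerContinuation a hb hcb).mono fun w hw =>
      mem_slit_of_norm_lt_one (mem_ball_zero_iff.1 hw)
  have h2 : AnalyticOnNhd ℂ (ordinaryHypergeometric a b c) (Metric.ball (0 : ℂ) 1) :=
    (differentiableOn_gauss a b c).analyticOnNhd Metric.isOpen_ball
  have h3 : ∃ᶠ w in 𝓝[≠] (0 : ℂ), eulerContinuation a b c w = ordinaryHypergeometric a b c w := by
    have ht : Tendsto (fun x : ℝ => (x : ℂ)) (𝓝[>] 0) (𝓝[≠] 0) := by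
      refine tendsto_nhdsWithin_iff.2 ⟨?_, ?_⟩
      · exact (Complex.continuous_ofReal.tendsto' 0 0 Complex.ofReal_zero).mono_left
          nhdsWithin_le_nhds
      · filter_upwards [self_mem_nhdsWithin] with x hx
        exact Complex.ofReal_ne_zero.2 (ne_of_gt hx)
    refine ht.frequently (Eventually.frequently ?_)
    filter_upwards [Ioo_mem_nhdsGT one_pos] with x hx
    exact eulerContinuation_ofReal a hb hcb hx.1 hx.2
  intro z hz
  exact h1.eqOn_of_preconnected_of_frequently_eq h2 (convex_ball _ _).isPreconnected
    (Metric.mem_ball_self one_pos) h3 (mem_ball_zero_iff.2 hz)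

/-! ### The hypergeometric function on the slit plane -/

/-- This carries identities between power series from the disc to the whole slit plane. -/
theorem eqOn_slit_of_eqOn_ball {f g : ℂ → ℂ} (hf : AnalyticOnNhd ℂ f slit)
    (hg : AnalyticOnNhd ℂ g slit) (h : ∀ z : ℂ, ‖z‖ < 1 → f z = g z) : Set.EqOn f g slit :=
  hf.eqOn_of_preconnected_of_eventuallyEq hg isPreconnected_slit zero_mem_slit <| by
    filter_upwards [Metric.ball_mem_nhds (0 : ℂ) one_pos] with z hz
    exact h z (mem_ball_zero_iff.1 hz)

theorem IsGaussContinuation.comm {a b c : ℂ} {f : ℂ → ℂ} (h : IsGaussContinuation a b c f) :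
    IsGaussContinuation b a c f :=
  ⟨h.1, fun z hz => by rw [h.2 z hz, ordinaryHypergeometric_comm]⟩

theorem IsGaussContinuation.contiguous {a b c : ℂ} (hc : Admissible c) {f g : ℂ → ℂ}
    (hf : IsGaussContinuation a (b + 1) (c + 1) f)
    (hg : IsGaussContinuation (a + 1) (b + 1) (c + 2) g) :
    IsGaussContinuation a b c fun z => f z - a * (c - b) / (c * (c + 1)) * z * g z :=
  ⟨hf.1.sub ((analyticOnNhd_const.mul analyticOnNhd_id).mul hg.1), fun z hz => by
    simp only [gauss_contiguous hc a b hz, hf.2 z hz, hg.2 z hz]⟩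

/-- Euler's integral needs Re b > 0 and Re (c-b) > 0. The contiguous relation expresses F(a,b,c)
through functions with b raised by 1 and with c-b not lowered, so the first condition is removed by
induction. -/
theorem exists_isGaussContinuation_of_re_pos (N : ℕ) : ∀ a b c : ℂ, Admissible c →
    0 < b.re + N → 0 < (c - b).re → ∃ f, IsGaussContinuation a b c f := by
  induction N with
  | zero => exact fun a b c _ hb hcb =>
      ⟨_, isGaussContinuation_eulerContinuation a (by simpa using hb) hcb⟩
  | succ N ih =>
    intro a b c hc hb hcb
    push_cast at hb
    simp only [Complex.sub_re] at hcb
    obtain ⟨f, hf⟩ := ih a (b + 1) (c + 1) hc.add_one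
      (by rw [Complex.add_re, Complex.one_re]; linarith) (by simpa using hcb)
    obtain ⟨g, hg⟩ := ih (a + 1) (b + 1) (c + 2) hc.add_two
      (by rw [Complex.add_re, Complex.one_re]; linarith)
      (by simp only [Complex.sub_re, Complex.add_re, Complex.one_re, Complex.re_ofNat]; linarith)
    exact ⟨_, hf.contiguous hc hg⟩

/-- The contiguous relation with a and b exchanged raises c-b by 1 in both terms and does not lower
b, which removes the second condition. -/
theorem exists_isGaussContinuation_aux (N M : ℕ) : ∀ a b c : ℂ, Admissible c →
    0 < b.re + N → 0 < (c - b).re + M → ∃ f, IsGaussContinuation a b c f := by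
  induction M with
  | zero => exact fun a b c hc hb hcb =>
      exists_isGaussContinuation_of_re_pos N a b c hc hb (by simpa using hcb)
  | succ M ih =>
    intro a b c hc hb hcb
    push_cast at hcb
    simp only [Complex.sub_re] at hcb
    obtain ⟨f, hf⟩ := ih (a + 1) b (c + 1) hc.add_one hb
      (by simp only [Complex.sub_re, Complex.add_re, Complex.one_re]; linarith)
    obtain ⟨g, hg⟩ := ih (a + 1) (b + 1) (c + 2) hc.add_two
      (by rw [Complex.add_re, Complex.one_re]; linarith)
      (by simp only [Complex.sub_re, Complex.add_re, Complex.one_re, Complex.re_ofNat]; linarith)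
    exact ⟨_, (hf.comm.contiguous hc hg.comm).comm⟩

theorem exists_isGaussContinuation (a b : ℂ) {c : ℂ} (hc : Admissible c) :
    ∃ f, IsGaussContinuation a b c f := by
  obtain ⟨N, hN⟩ := exists_nat_gt (-b.re)
  obtain ⟨M, hM⟩ := exists_nat_gt (-(c - b).re)
  exact exists_isGaussContinuation_aux N M a b c hc (by linarith) (by linarith)

theorem isGaussContinuation_F (a b : ℂ) {c : ℂ} (hc : Admissible c) :
    IsGaussContinuation a b c (F a b c) := by
  have h := exists_isGaussContinuation a b hc
  rw [F, dif_pos h]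
  exact h.choose_spec

theorem analyticOnNhd_F (a b : ℂ) {c : ℂ} (hc : Admissible c) :
    AnalyticOnNhd ℂ (F a b c) slit :=
  (isGaussContinuation_F a b hc).1

theorem IsGaussContinuation.eqOn {a b c : ℂ} (hc : Admissible c) {f : ℂ → ℂ}
    (hf : IsGaussContinuation a b c f) : Set.EqOn (F a b c) f slit :=
  eqOn_slit_of_eqOn_ball (analyticOnNhd_F a b hc) hf.1 fun z hz => by
    rw [(isGaussContinuation_F a b hc).2 z hz, hf.2 z hz]

theorem F_zero (a b : ℂ) {c : ℂ} (hc : Admissible c) : F a b c 0 = 1 := by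
  rw [(isGaussContinuation_F a b hc).2 0 (by simp), ordinaryHypergeometric_zero]

theorem F_comm (a b : ℂ) {c : ℂ} (hc : Admissible c) {w : ℂ} (hw : w ∈ slit) :
    F a b c w = F b a c w :=
  (isGaussContinuation_F b a hc).comm.eqOn hc hw

theorem F_contiguous (a b : ℂ) {c : ℂ} (hc : Admissible c) {w : ℂ} (hw : w ∈ slit) :
    F a b c w = F a (b + 1) (c + 1) w -
      a * (c - b) / (c * (c + 1)) * w * F (a + 1) (b + 1) (c + 2) w :=
  ((isGaussContinuation_F a (b + 1) hc.add_one).contiguous hc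
    (isGaussContinuation_F (a + 1) (b + 1) hc.add_two)).eqOn hc hw

theorem IsGaussContinuation.deriv_eq {a b c : ℂ} {f : ℂ → ℂ} (h : IsGaussContinuation a b c f)
    {z : ℂ} (hz : ‖z‖ < 1) : deriv f z = deriv (ordinaryHypergeometric a b c) z := by
  refine Filter.EventuallyEq.deriv_eq ?_
  filter_upwards [Metric.isOpen_ball.mem_nhds (mem_ball_zero_iff.2 hz)] with y hy
  exact h.2 y (mem_ball_zero_iff.1 hy)

theorem deriv_F_eq (a b : ℂ) {c : ℂ} (hc : Admissible c) {w : ℂ} (hw : w ∈ slit) :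
    (1 - w) * deriv (F a b c) w = a * F a b c w + a * (b - c) / c * F (a + 1) b (c + 1) w := by
  have h1 := isGaussContinuation_F a b hc
  have h2 := isGaussContinuation_F (a + 1) b hc.add_one
  refine eqOn_slit_of_eqOn_ball (f := fun w => (1 - w) * deriv (F a b c) w)
    (g := fun w => a * F a b c w + a * (b - c) / c * F (a + 1) b (c + 1) w)
    ((analyticOnNhd_const.sub analyticOnNhd_id).mul h1.1.deriv)
    ((analyticOnNhd_const.mul h1.1).add (analyticOnNhd_const.mul h2.1)) (fun z hz => ?_) hw
  simp only [h1.2 z hz, h2.2 z hz, h1.deriv_eq hz]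
  exact gauss_deriv_eq hc a b hz

theorem deriv_F_add_one_eq {a : ℂ} (ha : a ≠ 0) (b : ℂ) {c : ℂ} (hc : Admissible c) {w : ℂ}
    (hw : w ∈ slit) :
    w * deriv (F (a + 1) b (c + 1)) w = c * F a b c w - c * F (a + 1) b (c + 1) w +
      c / a * (w * deriv (F a b c) w) := by
  have h1 := isGaussContinuation_F a b hc
  have h2 := isGaussContinuation_F (a + 1) b hc.add_one
  refine eqOn_slit_of_eqOn_ball (f := fun w => w * deriv (F (a + 1) b (c + 1)) w)
    (g := fun w => c * F a b c w - c * F (a + 1) b (c + 1) w + c / a * (w * deriv (F a b c) w))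
    (analyticOnNhd_id.mul h2.1.deriv)
    (((analyticOnNhd_const.mul h1.1).sub (analyticOnNhd_const.mul h2.1)).add
      (analyticOnNhd_const.mul (analyticOnNhd_id.mul h1.1.deriv))) (fun z hz => ?_) hw
  simp only [h1.2 z hz, h2.2 z hz, h1.deriv_eq hz, h2.deriv_eq hz]
  exact gauss_deriv_add_one_eq hc ha b hz

/-! ### Zeros -/

theorem natCast_le_analyticOrderAt_mul_add_mul {f g A B : ℂ → ℂ} {x : ℂ} {n : ℕ}
    (hf : AnalyticAt ℂ f x) (hg : AnalyticAt ℂ g x) (hA : AnalyticAt ℂ A x)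
    (hB : AnalyticAt ℂ B x) (hnf : n ≤ analyticOrderAt f x) (hng : n ≤ analyticOrderAt g x) :
    n ≤ analyticOrderAt (A * f + B * g) x := by
  refine le_trans (le_min ?_ ?_) le_analyticOrderAt_add
  · rw [analyticOrderAt_mul hA hf]
    exact hnf.trans le_add_self
  · rw [analyticOrderAt_mul hB hg]
    exact hng.trans le_add_self

/-- A solution of a regular linear first order system that vanishes at a point vanishes near it. -/
theorem analyticOrderAt_eq_top_of_system {f g A B C D : ℂ → ℂ} {x : ℂ} (hf : AnalyticAt ℂ f x)
    (hg : AnalyticAt ℂ g x) (hA : AnalyticAt ℂ A x) (hB : AnalyticAt ℂ B x)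
    (hC : AnalyticAt ℂ C x) (hD : AnalyticAt ℂ D x)
    (h1 : deriv f =ᶠ[𝓝 x] A * f + B * g) (h2 : deriv g =ᶠ[𝓝 x] C * f + D * g)
    (hfx : f x = 0) (hgx : g x = 0) : analyticOrderAt f x = ⊤ := by
  -- If f and g vanish to order n, the system makes f' and g' vanish to order n, hence f and g to
  -- order n+1.
  have key : ∀ n : ℕ, n ≤ analyticOrderAt f x ∧ n ≤ analyticOrderAt g x := by
    intro n
    induction n with
    | zero => simp
    | succ n ih =>
      push_cast
      rw [← analyticOrderAt_deriv_ge_iff hf hfx, ← analyticOrderAt_deriv_ge_iff hg hgx,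
        analyticOrderAt_congr h1, analyticOrderAt_congr h2]
      exact ⟨natCast_le_analyticOrderAt_mul_add_mul hf hg hA hB ih.1 ih.2,
        natCast_le_analyticOrderAt_mul_add_mul hf hg hC hD ih.1 ih.2⟩
  exact ENat.eq_top_iff_forall_ge.2 fun n => (key n).1

/-- Otherwise F would vanish on the connected slit plane, against F(0) = 1. -/
theorem analyticOrderAt_F_ne_top (a b : ℂ) {c : ℂ} (hc : Admissible c) {w : ℂ} (hw : w ∈ slit) :
    analyticOrderAt (F a b c) w ≠ ⊤ := by
  intro h
  rw [analyticOrderAt_eq_top] at h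
  have h1 : Set.EqOn (F a b c) (fun _ => 0) slit :=
    (analyticOnNhd_F a b hc).eqOn_of_preconnected_of_eventuallyEq analyticOnNhd_const
      isPreconnected_slit hw h
  have h2 := h1 zero_mem_slit
  rw [F_zero a b hc] at h2
  exact one_ne_zero h2

/-- `F(a, b, c)` and `F(a+1, b, c+1)` have no common zero. -/
theorem F_add_one_ne_zero_of_F_eq_zero {a : ℂ} (ha : a ≠ 0) (b : ℂ) {c : ℂ} (hc : Admissible c)
    {w : ℂ} (hw : w ∈ slit) (hw0 : w ≠ 0) (h : F a b c w = 0) : F (a + 1) b (c + 1) w ≠ 0 := by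
  intro h'
  have h1w := one_sub_ne_zero_of_mem_slit hw
  have hnhds : ∀ᶠ y in 𝓝 w, y ∈ slit ∧ y ≠ 0 :=
    (isOpen_slit.eventually_mem hw).and (isOpen_ne.eventually_mem hw0)
  -- All coefficients of the system for F(a,b,c) and F(a+1,b,c+1) have the form p/y + q/(1-y),
  -- analytic away from 0 and 1.
  have hk (p q : ℂ) : AnalyticAt ℂ (fun y => p / y + q / (1 - y)) w :=
    (analyticAt_const.div analyticAt_id hw0).add
      (analyticAt_const.div (analyticAt_const.sub analyticAt_id) h1w)
  refine analyticOrderAt_F_ne_top a b hc hw (analyticOrderAt_eq_top_of_system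
    (analyticOnNhd_F a b hc w hw) (analyticOnNhd_F (a + 1) b hc.add_one w hw)
    (hk 0 a) (hk 0 (a * (b - c) / c)) (hk c c) (hk (-c) (b - c)) ?_ ?_ h h')
  · filter_upwards [hnhds] with y hy
    have h1 := deriv_F_eq a b hc hy.1
    have h2 := one_sub_ne_zero_of_mem_slit hy.1
    have h3 := hc.ne_zero
    simp only [Pi.add_apply, Pi.mul_apply]
    field_simp at h1 ⊢
    linear_combination h1
  · filter_upwards [hnhds] with y hy
    have h1 := deriv_F_eq a b hc hy.1
    have h2 := one_sub_ne_zero_of_mem_slit hy.1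
    have h3 := hc.ne_zero
    have h4 := deriv_F_add_one_eq ha b hc hy.1
    have h5 := hy.2
    simp only [Pi.add_apply, Pi.mul_apply]
    field_simp at h1 h4 ⊢
    refine mul_left_cancel₀ ha ?_
    linear_combination (1 - y) * h4 + y * h1

/-- The coupling constant a(b-c)/c vanishes, so F alone solves (1-w) F' = a F, a system with second
component 0. -/
theorem F_ne_zero_of_eq_zero_or_eq {a b c : ℂ} (hc : Admissible c) (h : a = 0 ∨ b = c) {w : ℂ}
    (hw : w ∈ slit) : F a b c w ≠ 0 := by
  intro h'
  refine analyticOrderAt_F_ne_top a b hc hw (analyticOrderAt_eq_top_of_system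
    (g := 0) (A := fun y => a / (1 - y)) (B := 0) (C := 0) (D := 0)
    (analyticOnNhd_F a b hc w hw) analyticAt_const
    (analyticAt_const.div (analyticAt_const.sub analyticAt_id) (one_sub_ne_zero_of_mem_slit hw))
    analyticAt_const analyticAt_const analyticAt_const ?_ ?_ h' rfl)
  · filter_upwards [isOpen_slit.mem_nhds hw] with y hy
    have h1 := deriv_F_eq a b hc hy
    have h2 := one_sub_ne_zero_of_mem_slit hy
    have h3 : a * (b - c) / c = 0 := by rcases h with h | h <;> simp [h]
    rw [h3] at h1
    simp only [Pi.add_apply, Pi.mul_apply, Pi.zero_apply]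
    field_simp
    linear_combination h1
  · simp only [mul_zero, add_zero]
    exact Eventually.of_forall fun y => by simp

theorem F_ne_zero_of_degenerate {a b c : ℂ} (hc : Admissible c)
    (h : a = 0 ∨ b = 0 ∨ a = c ∨ b = c) {w : ℂ} (hw : w ∈ slit) : F a b c w ≠ 0 := by
  have h' : (a = 0 ∨ b = c) ∨ b = 0 ∨ a = c := by tauto
  rcases h' with h | h
  · exact F_ne_zero_of_eq_zero_or_eq hc h hw
  · rw [F_comm a b hc hw]
    exact F_ne_zero_of_eq_zero_or_eq hc h hw

/-! ### Decay for large parameters -/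

theorem betaWeight_add_natCast (u v : ℂ) (k : ℕ) {t : ℝ} (ht : t ∈ Set.Ioo (0 : ℝ) 1) :
    betaWeight (u + k) (v + k) t = betaWeight u v t * ((t : ℂ) * (1 - t)) ^ k := by
  have h1 : (t : ℂ) ≠ 0 := Complex.ofReal_ne_zero.2 ht.1.ne'
  have h2 : (1 - t : ℂ) ≠ 0 := by exact_mod_cast (sub_pos.2 ht.2).ne'
  rw [betaWeight, betaWeight, show u + k - 1 = u - 1 + k by ring,
    show v + k - 1 = v - 1 + k by ring, Complex.cpow_add _ _ h1, Complex.cpow_add _ _ h2,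
    Complex.cpow_natCast, Complex.cpow_natCast, mul_pow]
  ring

/-- Both exponents, a-c and -a, drop by k under this shift; hence the choice of 2k in the third
parameter. -/
theorem eulerKernel_add_natCast (a c : ℂ) (k : ℕ) {x : ℂ} (hx : ‖x‖ < 1) :
    eulerKernel (a + k) (c + 2 * k) x = eulerKernel a c x * ((1 - x ^ 2)⁻¹) ^ k := by
  have h1 := Complex.slitPlane_ne_zero (mem_slitPlane_one_sub hx)
  have h2 := Complex.slitPlane_ne_zero (mem_slitPlane_one_add hx)
  rw [eulerKernel, eulerKernel, show a + k - (c + 2 * k) = a - c - k by ring,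
    show -(a + k) = -a - k by ring, Complex.cpow_sub _ _ h1, Complex.cpow_sub _ _ h2,
    Complex.cpow_natCast, Complex.cpow_natCast, show 1 - x ^ 2 = (1 - x) * (1 + x) by ring,
    inv_pow, mul_pow]
  field_simp

/-- Since |x| < 1, the denominator has modulus at least 1 - (1-2t)² = 4t(1-t), so the bound does not
depend on x or t. -/
theorem norm_mul_inv_one_sub_sq_le {x : ℂ} (hx : ‖x‖ < 1) {t : ℝ} (ht : t ∈ Set.Ioo (0 : ℝ) 1) :
    ‖(t : ℂ) * (1 - t) * (1 - (x * (1 - 2 * (t : ℂ))) ^ 2)⁻¹‖ ≤ 1 / 4 := by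
  have h0 : 0 < t * (1 - t) := mul_pos ht.1 (sub_pos.2 ht.2)
  have h1 : 4 * (t * (1 - t)) ≤ ‖1 - (x * (1 - 2 * (t : ℂ))) ^ 2‖ := by
    have h2 : ‖(x * (1 - 2 * (t : ℂ))) ^ 2‖ ≤ (1 - 2 * t) ^ 2 := by
      rw [show (1 - 2 * (t : ℂ)) = ((1 - 2 * t : ℝ) : ℂ) by push_cast; ring, norm_pow, norm_mul,
        Complex.norm_real, mul_pow, Real.norm_eq_abs, sq_abs]
      exact mul_le_of_le_one_left (sq_nonneg _) (pow_le_one₀ (norm_nonneg _) hx.le)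
    have h3 := norm_sub_norm_le (1 : ℂ) ((x * (1 - 2 * (t : ℂ))) ^ 2)
    rw [norm_one] at h3
    nlinarith
  rw [norm_mul, norm_inv, show (t : ℂ) * (1 - t) = ((t * (1 - t) : ℝ) : ℂ) by push_cast; ring,
    Complex.norm_of_nonneg h0.le, ← div_eq_mul_inv, div_le_iff₀ (by linarith)]
  linarith

theorem exists_norm_eulerTransform_le (a : ℂ) {b c : ℂ} (hb : 0 < b.re) (hcb : 0 < (c - b).re)
    {x : ℂ} (hx : ‖x‖ < 1) :
    ∃ M, ∀ k : ℕ, ‖eulerTransform (a + k) (b + k) (c + 2 * k) x‖ ≤ M * (1 / 4) ^ k := by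
  have hint := integrableOn_mul_comp_segment (differentiableOn_eulerKernel a c).continuousOn
    (integrableOn_betaWeight hb hcb) hx
  refine ⟨∫ t in Set.Ioo (0 : ℝ) 1,
    ‖betaWeight b (c - b) t * eulerKernel a c (x * (1 - 2 * (t : ℂ)))‖, fun k => ?_⟩
  rw [← integral_mul_const]
  refine norm_integral_le_of_norm_le (hint.norm.mul_const _) ?_
  filter_upwards [ae_restrict_mem measurableSet_Ioo] with t ht
  rw [show c + 2 * k - (b + k) = c - b + k by ring, betaWeight_add_natCast _ _ _ ht,
    eulerKernel_add_natCast _ _ _ ((norm_mul_one_sub_two_mul_le x ht).trans_lt hx),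
    mul_mul_mul_comm, ← mul_pow, norm_mul, norm_pow]
  gcongr
  exact norm_mul_inv_one_sub_sq_le hx ht

/-- The shift leaves c-a-b unchanged and brings out (1+x)²ᵏ, which cancels the denominator of (w/4)ᵏ
= xᵏ/(1+x)²ᵏ. The surviving xᵏ gives the decay. -/
theorem pow_mul_eulerContinuation (a b c : ℂ) (k : ℕ) {w : ℂ} (hw : w ∈ slit) :
    (w / 4) ^ k * eulerContinuation (a + k) (b + k) (c + 2 * k) w =
      sqrtVar w ^ (c - a - b) * (1 + discVar w) ^ c * (discVar w ^ k /
        Complex.betaIntegral (b + k) (c - b + k) *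
          eulerTransform (a + k) (b + k) (c + 2 * k) (discVar w)) := by
  have h1 := one_add_discVar_ne_zero hw
  rw [eulerContinuation, eq_discVar hw, show c + 2 * k - (a + k) - (b + k) = c - a - b by ring,
    show c + 2 * k - (b + k) = c - b + k by ring, Complex.cpow_add _ _ h1,
    show (2 * (k : ℂ)) = ((2 * k : ℕ) : ℂ) by push_cast; ring, Complex.cpow_natCast, div_pow,
    ← pow_mul]
  field_simp

theorem betaIntegral_add_one_add_one {u v : ℂ} (hu : 0 < u.re) (hv : 0 < v.re) :
    Complex.betaIntegral (u + 1) (v + 1) =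
      u / (u + v) * (v / (u + v + 1)) * Complex.betaIntegral u v := by
  rw [betaIntegral_add_one_right (by simpa using add_pos hu one_pos) hv,
    betaIntegral_add_one_left hu hv, show u + 1 + v = u + v + 1 by ring]
  ring

/-- The majorant `(r/4)^k ∏ |γᵢ| / |Β(b+k, c-b+k)|` is square summable for `r < 1`. -/
theorem summable_majorant {b c : ℂ} (hb : 0 < b.re) (hcb : 0 < (c - b).re) {γ : ℕ → ℂ}
    (hγ : Tendsto (fun k => ‖γ k‖) atTop (𝓝 1)) {r : ℝ} (hr0 : 0 ≤ r) (hr : r < 1) :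
    Summable fun k : ℕ => ((r / 4) ^ k / ‖Complex.betaIntegral (b + k) (c - b + k)‖ *
      ∏ i ∈ Finset.range k, ‖γ i‖) ^ 2 := by
  obtain ⟨s, hs, hs1⟩ := exists_between hr
  have hs0 : 0 ≤ s := hr0.trans hs.le
  -- Consecutive Beta values have ratio tending to 1/4, so the factor r/4 becomes r in the limit,
  -- and the ratio test applies to the squares with s².
  have hratio : Tendsto (fun k : ℕ => r / 4 *
      ‖(b + k) / (c + 2 * k) * ((c - b + k) / (c + 1 + 2 * k))‖⁻¹ * ‖γ k‖) atTop (𝓝 r) := by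
    have h1 := (((tendsto_ratio b c).mul (tendsto_ratio (c - b) (c + 1))).norm.inv₀
      (by norm_num)).const_mul (r / 4)
    convert h1.mul hγ using 2
    norm_num
  refine summable_of_ratio_norm_eventually_le (r := s ^ 2) (by nlinarith) ?_
  filter_upwards [hratio.eventually_le_const hs] with k hk
  rw [norm_pow, norm_pow, ← mul_pow]
  refine pow_le_pow_left₀ (norm_nonneg _) ?_ 2
  have hbeta := betaIntegral_add_one_add_one (add_natCast_re_pos hb k) (add_natCast_re_pos hcb k)
  rw [show b + k + (c - b + k) = c + 2 * k by ring,
    show c + 2 * (k : ℂ) + 1 = c + 1 + 2 * k by ring] at hbeta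
  rw [Real.norm_of_nonneg (by positivity), Real.norm_of_nonneg (by positivity), Nat.cast_succ,
    ← add_assoc, ← add_assoc, hbeta, norm_mul, Finset.prod_range_succ, pow_succ]
  generalize ‖(b + k) / (c + 2 * k) * ((c - b + k) / (c + 1 + 2 * k))‖ = y at *
  calc _ = (r / 4 * y⁻¹ * ‖γ k‖) * ((r / 4) ^ k / ‖Complex.betaIntegral (b + k) (c - b + k)‖ *
      ∏ i ∈ Finset.range k, ‖γ i‖) := by
        simp only [div_eq_mul_inv, mul_inv]
        ring
    _ ≤ _ := by gcongr

theorem summable_decay_of_re_pos (a : ℂ) {b c : ℂ} (hb : 0 < b.re) (hcb : 0 < (c - b).re)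
    {γ : ℕ → ℂ} (hγ : Tendsto (fun k => ‖γ k‖) atTop (𝓝 1)) {w : ℂ} (hw : w ∈ slit) :
    Summable fun k : ℕ => ‖(w / 4) ^ k * (∏ i ∈ Finset.range k, γ i) *
      F (a + k) (b + k) (c + 2 * k) w‖ ^ 2 := by
  have hx := norm_discVar_lt_one hw
  obtain ⟨M, hM⟩ := exists_norm_eulerTransform_le a hb hcb hx
  refine Summable.of_nonneg_of_le (fun k => by positivity) (fun k => ?_)
    ((summable_majorant hb hcb hγ (norm_nonneg (discVar w)) hx).mul_left
      ((‖sqrtVar w ^ (c - a - b) * (1 + discVar w) ^ c‖ * M) ^ 2))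
  have hc : Admissible c := admissible_of_re_pos (by
    have := add_pos hb hcb
    rwa [← Complex.add_re, add_sub_cancel] at this)
  have hc' : Admissible (c + 2 * k) := by
    simpa using hc.add_natCast (2 * k)
  have hF : F (a + k) (b + k) (c + 2 * k) w = eulerContinuation (a + k) (b + k) (c + 2 * k) w :=
    (isGaussContinuation_eulerContinuation (a + k) (add_natCast_re_pos hb k) (by
      rw [show c + 2 * k - (b + k) = c - b + k by ring]
      exact add_natCast_re_pos hcb k)).eqOn hc' hw
  rw [← mul_pow, mul_right_comm, hF, pow_mul_eulerContinuation a b c k hw, norm_mul, norm_mul,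
    norm_mul (discVar w ^ k / _), norm_div, norm_pow, norm_prod]
  refine pow_le_pow_left₀ (by positivity) ?_ 2
  calc _ ≤ ‖sqrtVar w ^ (c - a - b) * (1 + discVar w) ^ c‖ * (‖discVar w‖ ^ k /
        ‖Complex.betaIntegral (b + k) (c - b + k)‖ * (M * (1 / 4) ^ k)) *
          ∏ i ∈ Finset.range k, ‖γ i‖ := by
        gcongr
        exact hM k
    _ = _ := by
        rw [div_pow, div_pow, one_pow]
        ring

/-- Dropping the first N terms shifts the parameters into the range of Euler's integral. -/
theorem summable_decay (a b : ℂ) {c : ℂ} {γ : ℕ → ℂ}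
    (hγ : Tendsto (fun k => ‖γ k‖) atTop (𝓝 1)) {w : ℂ} (hw : w ∈ slit) :
    Summable fun k : ℕ => ‖(w / 4) ^ k * (∏ i ∈ Finset.range k, γ i) *
      F (a + k) (b + k) (c + 2 * k) w‖ ^ 2 := by
  obtain ⟨N, hN⟩ := exists_nat_gt (max (-b.re) (-(c - b).re))
  rw [max_lt_iff] at hN
  rw [← summable_nat_add_iff N]
  have h := summable_decay_of_re_pos (a + N) (b := b + N) (c := c + 2 * N) (by simp; linarith)
    (by
      rw [show c + 2 * N - (b + N) = c - b + N by ring, Complex.add_re, Complex.natCast_re]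
      linarith)
    (γ := fun k => γ (N + k)) (by
      simpa only [add_comm N] using (tendsto_add_atTop_iff_nat N).2 hγ) hw
  refine (h.mul_left (‖(w / 4) ^ N * ∏ i ∈ Finset.range N, γ i‖ ^ 2)).congr fun k => ?_
  rw [← mul_pow, ← norm_mul, add_comm k N, Finset.prod_range_add, pow_add]
  push_cast
  rw [add_assoc a, add_assoc b, show c + 2 * (N : ℂ) + 2 * k = c + 2 * (N + k) by ring]
  congr 2
  ring

/-! ### The recurrence satisfied by the hypergeometric solution -/

theorem dOdd_add (a b c : ℂ) (m j : ℕ) :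
    dOdd (a + m) (b + m) (c + 2 * m) j = dOdd a b c (m + j) := by
  simp only [dOdd]
  push_cast
  congr 1 <;> ring

theorem dEven_add (a b c : ℂ) (m j : ℕ) :
    dEven (a + m) (b + m) (c + 2 * m) j = dEven a b c (m + j) := by
  simp only [dEven]
  push_cast
  congr 1 <;> ring

theorem offDiagSq_add (a b c : ℂ) (m k : ℕ) :
    offDiagSq (a + m) (b + m) (c + 2 * m) k = offDiagSq a b c (m + k) := by
  simp only [offDiagSq]
  push_cast
  congr 2 <;> ring

theorem Admissible.add_two_mul {c : ℂ} (hc : Admissible c) (m : ℕ) : Admissible (c + 2 * m) := by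
  simpa using hc.add_natCast (2 * m)

theorem F_eq_sub_dOdd (a b : ℂ) {c : ℂ} (hc : Admissible c) {w : ℂ} (hw : w ∈ slit) :
    F a b c w = F a (b + 1) (c + 1) w -
      dOdd a b c 0 * w * F (a + 1) (b + 1) (c + 2) w := by
  rw [F_contiguous a b hc hw, dOdd]
  simp

theorem F_eq_sub_dEven (a b : ℂ) {c : ℂ} (hc : Admissible c) {w : ℂ} (hw : w ∈ slit) :
    F a (b + 1) (c + 1) w = F (a + 1) (b + 1) (c + 2) w -
      dEven a b c 1 * w * F (a + 1) (b + 2) (c + 3) w := by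
  have h := F_contiguous (b + 1) a hc.add_one hw
  rw [show c + 1 + 1 = c + 2 by ring, show c + 1 + 2 = c + 3 by ring,
    show b + 1 + 1 = b + 2 by ring, F_comm (b + 1) a hc.add_one hw,
    F_comm (b + 1) (a + 1) hc.add_two hw,
    F_comm (b + 2) (a + 1) (by simpa using hc.add_natCast 3) hw] at h
  rw [h, dEven]
  congr 3
  push_cast
  congr 1 <;> ring

/-- Eliminating F(a+1,b+2,c+3) between two consecutive contiguous relations is the contraction that
turns the continued fraction with coefficients dⱼ into a Jacobi recurrence. -/
theorem F_three_term (a b : ℂ) {c : ℂ} (hc : Admissible c) {w : ℂ} (hw : w ∈ slit) :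
    F a (b + 1) (c + 1) w = (1 - dEven a b c 1 * w) * F (a + 1) (b + 1) (c + 2) w -
      dEven a b c 1 * dOdd a b c 1 * w ^ 2 * F (a + 2) (b + 2) (c + 4) w := by
  have h1 := F_eq_sub_dEven a b hc hw
  have h2 := F_eq_sub_dOdd (a + 1) (b + 1) hc.add_two hw
  have h3 := dOdd_add a b c 1 0
  simp only [Nat.cast_one, mul_one, add_zero] at h3
  rw [h3, show b + 1 + 1 = b + 2 by ring, show c + 2 + 1 = c + 3 by ring,
    show a + 1 + 1 = a + 2 by ring, show c + 2 + 2 = c + 4 by ring] at h2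
  linear_combination h1 + dEven a b c 1 * w * h2

/-- The solution `uⱼ = (-w/4)ʲ β₀ ⋯ βⱼ₋₁ F(a+1+j, b+1+j, c+2+2j; w)` of the recurrence. -/
def hypSol (a b c : ℂ) (β : ℕ → ℂ) (w : ℂ) (j : ℕ) : ℂ :=
  (-(w / 4)) ^ j * (∏ i ∈ Finset.range j, β i) * F (a + 1 + j) (b + 1 + j) (c + 2 + 2 * j) w

variable {a b c w : ℂ} {β : ℕ → ℂ}

theorem hypSol_zero : hypSol a b c β w 0 = F (a + 1) (b + 1) (c + 2) w := by
  simp [hypSol]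

/-- The entry of index 1 contains β₀, so only β₀² enters and the choice of square root is
immaterial; the rest is the three-term relation. -/
theorem hypSol_first_row (hc : Admissible c) (hβ : β 0 ^ 2 = offDiagSq a b c 0) (hw : w ∈ slit)
    (hw0 : w ≠ 0) :
    (2 - 4 * dEven a b c 1 - (2 - 4 / w)) * hypSol a b c β w 0 + β 0 * hypSol a b c β w 1 =
      4 / w * F a (b + 1) (c + 1) w := by
  have h1 := F_three_term a b hc hw
  rw [offDiagSq_eq] at hβ
  rw [h1, hypSol_zero, hypSol, Finset.prod_range_one, Nat.cast_one,
    show a + 1 + 1 = a + 2 by ring, show b + 1 + 1 = b + 2 by ring,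
    show c + 2 + 2 * 1 = c + 4 by ring]
  field_simp
  linear_combination (-w ^ 2 * F (a + 2) (b + 2) (c + 4) w) * hβ

/-- With the term d₁ kept on the diagonal, the defect becomes F(a,b,c;w). This is the form taken by
every later row after a shift of the parameters. -/
theorem hypSol_first_row' (hc : Admissible c) (hβ : β 0 ^ 2 = offDiagSq a b c 0) (hw : w ∈ slit)
    (hw0 : w ≠ 0) :
    (2 - 4 * dOdd a b c 0 - 4 * dEven a b c 1 - (2 - 4 / w)) * hypSol a b c β w 0 +
      β 0 * hypSol a b c β w 1 = 4 / w * F a b c w := by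
  have h1 := hypSol_first_row hc hβ hw hw0
  have h2 := F_eq_sub_dOdd a b hc hw
  rw [hypSol_zero] at h1 ⊢
  rw [h2]
  field_simp at h1 ⊢
  linear_combination h1

theorem hypSol_succ (n : ℕ) (k : ℕ) : hypSol a b c β w (n + k) =
    (-(w / 4)) ^ n * (∏ i ∈ Finset.range n, β i) *
      hypSol (a + n) (b + n) (c + 2 * n) (fun i => β (n + i)) w k := by
  simp only [hypSol, Finset.prod_range_add, pow_add]
  push_cast
  rw [show a + n + 1 + k = a + 1 + (n + k) by ring, show b + n + 1 + k = b + 1 + (n + k) by ring,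
    show c + 2 * n + 2 + 2 * (k : ℂ) = c + 2 + 2 * (n + k) by ring]
  ring

/-- Row n+1 is the first row, with full diagonal entry, for the parameters shifted by n+1. Its
defect is proportional to F(a+n+1, b+n+1, c+2n+2; w), that is, to the entry of index n, and cancels
the subdiagonal term. -/
theorem hypSol_row (hc : Admissible c) (hβ : ∀ k, β k ^ 2 = offDiagSq a b c k) (hw : w ∈ slit)
    (hw0 : w ≠ 0) (n : ℕ) :
    β n * hypSol a b c β w n +
      (2 - 4 * dOdd a b c (n + 1) - 4 * dEven a b c (n + 2) - (2 - 4 / w)) *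
        hypSol a b c β w (n + 1) + β (n + 1) * hypSol a b c β w (n + 2) = 0 := by
  have h1 := hypSol_first_row' (a := a + (n + 1 : ℕ)) (b := b + (n + 1 : ℕ))
    (β := fun i => β (n + 1 + i)) (hc.add_two_mul (n + 1))
    (by rw [offDiagSq_add]; exact hβ _) hw hw0
  rw [dOdd_add, dEven_add] at h1
  have h2 := hypSol_succ (a := a) (b := b) (c := c) (w := w) (β := β) (n + 1) 0
  have h3 := hypSol_succ (a := a) (b := b) (c := c) (w := w) (β := β) (n + 1) 1
  simp only [add_zero, add_assoc, Nat.reduceAdd] at h1 h2 h3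
  rw [h2, h3, hypSol, Finset.prod_range_succ, pow_succ]
  rw [show a + 1 + (n : ℂ) = a + (n + 1 : ℕ) by push_cast; ring,
    show b + 1 + (n : ℂ) = b + (n + 1 : ℕ) by push_cast; ring,
    show c + 2 + 2 * (n : ℂ) = c + 2 * (n + 1 : ℕ) by push_cast; ring]
  have h4 : w * (4 / w) = 4 := by field_simp
  linear_combination ((-(w / 4)) ^ n * (∏ i ∈ Finset.range n, β i) * β n) *
    ((-(w / 4)) * h1 - F (a + (n + 1 : ℕ)) (b + (n + 1 : ℕ)) (c + 2 * (n + 1 : ℕ)) w / 4 * h4)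

/-- Only the moduli converge, as the signs of the square roots are arbitrary; the limit is √(16 ·
1/4 · 1/4). -/
theorem tendsto_norm_offDiag (hβ : ∀ k, β k ^ 2 = offDiagSq a b c k) :
    Tendsto (fun k => ‖β k‖) atTop (𝓝 1) := by
  have h1 : Tendsto (fun k => ‖offDiagSq a b c k‖) atTop (𝓝 1) := by
    have h := ((((tendsto_add_atTop_iff_nat 1).2 (tendsto_dEven a b c)).mul
      ((tendsto_add_atTop_iff_nat 1).2 (tendsto_dOdd a b c))).const_mul 16).norm
    simp only [← offDiagSq_eq] at h
    convert h using 2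
    norm_num
  have h2 := h1.sqrt
  rw [Real.sqrt_one] at h2
  refine h2.congr fun k => ?_
  rw [← hβ, norm_pow, Real.sqrt_sq (norm_nonneg _)]

theorem summable_hypSol (hβ : ∀ k, β k ^ 2 = offDiagSq a b c k) (hw : w ∈ slit) :
    Summable fun j => ‖hypSol a b c β w j‖ ^ 2 := by
  refine (summable_decay (a + 1) (b + 1) (c := c + 2) (tendsto_norm_offDiag hβ) hw).congr
    fun j => ?_
  simp only [hypSol, norm_mul, norm_pow, norm_neg]

theorem tendsto_zero_of_summable_norm_sq {u : ℕ → ℂ} (hu : Summable fun n => ‖u n‖ ^ 2) :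
    Tendsto u atTop (𝓝 0) := by
  have h := hu.tendsto_atTop_zero.sqrt
  simp only [Real.sqrt_zero, Real.sqrt_sq (norm_nonneg _)] at h
  exact tendsto_zero_iff_norm_tendsto_zero.2 h

/-- Constancy of the Casoratian of two null sequences satisfying a three-term recurrence. -/
theorem mul_eq_zero_of_recurrence {α β U V : ℕ → ℂ} {K : ℂ} (hβ : ∃ M : ℝ, ∀ n, ‖β n‖ ≤ M)
    (hU : Tendsto U atTop (𝓝 0)) (hV : Tendsto V atTop (𝓝 0))
    (hU0 : α 0 * U 0 + β 0 * U 1 = K) (hV0 : α 0 * V 0 + β 0 * V 1 = 0)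
    (hUn : ∀ n, β n * U n + α (n + 1) * U (n + 1) + β (n + 1) * U (n + 2) = 0)
    (hVn : ∀ n, β n * V n + α (n + 1) * V (n + 1) + β (n + 1) * V (n + 2) = 0) :
    K * V 0 = 0 := by
  have key : ∀ n, β n * (U (n + 1) * V n - U n * V (n + 1)) = K * V 0 := by
    intro n
    induction n with
    | zero => linear_combination V 0 * hU0 - U 0 * hV0
    | succ n ih =>
      linear_combination ih + V (n + 1) * hUn n - U (n + 1) * hVn n
  -- The constant value K V₀ of the weighted Casoratian must equal its limit, which is 0 for null
  -- sequences and bounded β.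
  have h1 : Tendsto (fun n => U (n + 1) * V n - U n * V (n + 1)) atTop (𝓝 0) := by
    simpa using (((tendsto_add_atTop_iff_nat 1).2 hU).mul hV).sub
      (hU.mul ((tendsto_add_atTop_iff_nat 1).2 hV))
  obtain ⟨M, hM⟩ := hβ
  have h2 : Tendsto (fun n => β n * (U (n + 1) * V n - U n * V (n + 1))) atTop (𝓝 0) := by
    refine squeeze_zero_norm (fun n => ?_) (by simpa using h1.norm.const_mul M)
    rw [norm_mul]
    gcongr
    exact hM n
  simp only [key] at h2
  exact tendsto_nhds_unique tendsto_const_nhds h2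

/-! ### Eigenvalues of the Jacobi operator -/

theorem hasEigenvalue_J_iff (hβ : ∀ k, β k ^ 2 = offDiagSq a b c k) {z : ℂ} :
    Module.End.HasEigenvalue (J a b c β hβ : ell2 →ₗ[ℂ] ell2) z ↔
      ∃ u : ell2, u ≠ 0 ∧ ∀ n, jacobiAction (diag a b c) β u n = z * u n := by
  constructor
  · intro h
    obtain ⟨u, hu⟩ := h.exists_hasEigenvector
    refine ⟨u, hu.2, fun n => ?_⟩
    have h1 : (J a b c β hβ : ell2 →ₗ[ℂ] ell2) u = z • u := hu.apply_eq_smul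
    exact congrFun (congrArg (fun v : ell2 => (v : ℕ → ℂ)) h1) n
  · rintro ⟨u, hu0, hu⟩
    refine Module.End.hasEigenvalue_of_hasEigenvector (x := u)
      ⟨Module.End.mem_eigenspace_iff.2 ?_, hu0⟩
    apply lp.ext
    funext n
    exact hu n

theorem hasEigenvalue_J_of_F_eq_zero (hc : Admissible c) (ha : a ≠ 0)
    (hβ : ∀ k, β k ^ 2 = offDiagSq a b c k) (hw : w ∈ slit) (hw0 : w ≠ 0)
    (h : F a (b + 1) (c + 1) w = 0) :
    Module.End.HasEigenvalue (J a b c β hβ : ell2 →ₗ[ℂ] ell2) (2 - 4 / w) := by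
  rw [hasEigenvalue_J_iff]
  refine ⟨⟨hypSol a b c β w, memlp_iff.2 (summable_hypSol hβ hw)⟩, fun h0 => ?_, fun n => ?_⟩
  -- The entry of index 0 is F(a+1,b+1,c+2;w), nonzero at a zero of F(a,b+1,c+1); so the vector is
  -- nonzero even if some β vanishes.
  · have h1 := congrFun (congrArg (fun v : ell2 => (v : ℕ → ℂ)) h0) 0
    have h2 := F_add_one_ne_zero_of_F_eq_zero ha (b + 1) hc.add_one hw hw0 h
    rw [show c + 1 + 1 = c + 2 by ring] at h2
    exact h2 (hypSol_zero.symm.trans h1)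
  · change jacobiAction (diag a b c) β (hypSol a b c β w) n = (2 - 4 / w) * hypSol a b c β w n
    cases n with
    | zero =>
      have h1 := hypSol_first_row hc (hβ 0) hw hw0
      rw [h, mul_zero] at h1
      rw [jacobiAction, diag]
      linear_combination h1
    | succ n =>
      rw [jacobiAction, diag]
      linear_combination hypSol_row hc hβ hw hw0 n

/-- A vanishing off-diagonal entry puts the parameters of the lower block in the case where
`F_ne_zero_of_degenerate` excludes zeros. -/
theorem degenerate_of_offDiagSq_eq_zero (hc : Admissible c) {k : ℕ}
    (h : offDiagSq a b c k = 0) :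
    a + (k + 1 : ℕ) = 0 ∨ b + (k + 1 : ℕ) = 0 ∨ a + (k + 1 : ℕ) = c + 2 * (k + 1 : ℕ) ∨
      b + (k + 1 : ℕ) = c + 2 * (k + 1 : ℕ) := by
  have h1 := hc.add_natCast_ne_zero (2 * k + 1)
  have h2 := hc.add_natCast_ne_zero (2 * k + 2)
  have h3 := hc.add_natCast_ne_zero (2 * k + 3)
  push_cast at h1 h2 h3 ⊢
  simp only [← add_assoc] at h1 h2 h3
  rw [offDiagSq, mul_eq_zero, div_eq_zero_iff] at h
  simp only [mul_eq_zero, pow_eq_zero_iff, ne_eq, OfNat.ofNat_ne_zero, not_false_eq_true, h1, h2,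
    h3, or_false, false_or] at h
  rcases h with ((h | h) | h) | h
  · exact Or.inl (by linear_combination h)
  · exact Or.inr (Or.inr (Or.inr (by linear_combination -h)))
  · exact Or.inr (Or.inl (by linear_combination h))
  · exact Or.inr (Or.inr (Or.inl (by linear_combination -h)))

theorem F_eq_zero_of_hasEigenvalue_J (hc : Admissible c)
    (hβ : ∀ k, β k ^ 2 = offDiagSq a b c k) (hw : w ∈ slit) (hw0 : w ≠ 0)
    (h : Module.End.HasEigenvalue (J a b c β hβ : ell2 →ₗ[ℂ] ell2) (2 - 4 / w)) :
    F a (b + 1) (c + 1) w = 0 := by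
  by_contra hF
  obtain ⟨u, hu0, hu⟩ := (hasEigenvalue_J_iff hβ).1 h
  apply hu0
  have hV : Tendsto (u : ℕ → ℂ) atTop (𝓝 0) :=
    tendsto_zero_of_summable_norm_sq (memlp_iff.1 (lp.memℓp u))
  have hbdd := offDiag_bounded a b c β hβ
  have h4 : 4 / w ≠ 0 := div_ne_zero (by norm_num) hw0
  have hV0 : (diag a b c 0 - (2 - 4 / w)) * u 0 + β 0 * u 1 = 0 := by
    have := hu 0
    rw [jacobiAction] at this
    linear_combination this
  have hVn : ∀ n, β n * u n + (diag a b c (n + 1) - (2 - 4 / w)) * u (n + 1) +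
      β (n + 1) * u (n + 2) = 0 := by
    intro n
    have := hu (n + 1)
    rw [jacobiAction] at this
    linear_combination this
  apply lp.ext
  funext m
  change u m = 0
  induction m using Nat.strong_induction_on with
  | _ m ih =>
  cases m with
  | zero =>
    have h1 := mul_eq_zero_of_recurrence (α := fun n => diag a b c n - (2 - 4 / w)) hbdd
      (tendsto_zero_of_summable_norm_sq (summable_hypSol hβ hw)) hV
      (hypSol_first_row hc (hβ 0) hw hw0) hV0 (hypSol_row hc hβ hw hw0) hVn
    exact (mul_eq_zero.1 h1).resolve_left (mul_ne_zero h4 hF)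
  | succ m =>
    have hm : β m * u (m + 1) = 0 := by
      cases m with
      | zero =>
        rw [ih 0 (by lia)] at hV0
        simpa using hV0
      | succ m =>
        have := hVn m
        rw [ih m (by lia), ih (m + 1) (by lia)] at this
        simpa using this
    rcases mul_eq_zero.1 hm with hm | hm
    -- Here the matrix splits. The lower block belongs to the parameters shifted by m+1 and keeps
    -- its full first diagonal entry, so `hypSol_first_row'` gives its defect, which is nonzero
    -- because the shifted parameters are degenerate.
    · have hβ' : ∀ k, β (m + 1 + k) ^ 2 =
          offDiagSq (a + (m + 1 : ℕ)) (b + (m + 1 : ℕ)) (c + 2 * (m + 1 : ℕ)) k := by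
        intro k
        rw [offDiagSq_add, hβ]
      have hc' := hc.add_two_mul (m + 1)
      have hdeg := degenerate_of_offDiagSq_eq_zero hc (k := m) (by rw [← hβ, hm]; ring)
      have hne := F_ne_zero_of_degenerate hc' hdeg hw
      have hrow0 := hypSol_first_row' (β := fun k => β (m + 1 + k)) hc' (hβ' 0) hw hw0
      have hrow := hypSol_row (β := fun k => β (m + 1 + k)) hc' hβ' hw hw0
      simp only [dOdd_add, dEven_add] at hrow0 hrow
      have h1 := mul_eq_zero_of_recurrence (α := fun n => diag a b c (m + 1 + n) - (2 - 4 / w))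
        (V := fun n => u (m + 1 + n)) (offDiag_bounded _ _ _ _ hβ')
        (tendsto_zero_of_summable_norm_sq (summable_hypSol hβ' hw))
        (by simpa only [add_comm (m + 1)] using (tendsto_add_atTop_iff_nat (m + 1)).2 hV)
        hrow0
        (by
          have := hVn m
          rw [ih m (by lia)] at this
          simpa using this)
        (by
          intro n
          rw [← hrow n]
          rfl)
        (fun n => hVn (m + 1 + n))
      exact (mul_eq_zero.1 h1).resolve_left (mul_ne_zero h4 hne)
    · exact hm

/-! ### Poles of `B` -/

/-- Inverting, z = 2 - 4/w, and w in [1, ∞) would put z in [-2, 2). -/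
theorem neg_four_div_mem_slit {z : ℂ} (hz : z ∈ offInterval) :
    z - 2 ≠ 0 ∧ -4 / (z - 2) ∈ slit := by
  have h2 : z - 2 ≠ 0 := by
    intro h
    refine hz ⟨2, by norm_num, ?_⟩
    push_cast
    linear_combination -h
  refine ⟨h2, ?_⟩
  rintro ⟨x, hx, hxz⟩
  rw [Set.mem_Ici] at hx
  have hx0 : 0 < x := by linarith
  refine hz ⟨2 - 4 / x, ⟨?_, ?_⟩, ?_⟩
  · have : 4 / x ≤ 4 := by rw [div_le_iff₀ hx0]; linarith
    linarith
  · have : 0 < 4 / x := by positivity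
    linarith
  · have hx' : (x : ℂ) ≠ 0 := Complex.ofReal_ne_zero.2 hx0.ne'
    push_cast
    rw [eq_div_iff h2] at hxz
    field_simp
    linear_combination -hxz

theorem analyticAt_F_neg_four_div (a b : ℂ) {c : ℂ} (hc : Admissible c) {z : ℂ}
    (hz : z ∈ offInterval) : AnalyticAt ℂ (fun z => F a b c (-4 / (z - 2))) z := by
  obtain ⟨h2, hw⟩ := neg_four_div_mem_slit hz
  exact (analyticOnNhd_F a b hc _ hw).fun_comp (f := fun z : ℂ => -4 / (z - 2))
    (analyticAt_const.div (analyticAt_id.sub analyticAt_const) h2)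

theorem meromorphicAt_B {a b c : ℂ} (hc : Admissible c) {z : ℂ} (hz : z ∈ offInterval) :
    MeromorphicAt (B a b c) z :=
  (MeromorphicAt.const _ z).mul (((analyticAt_F_neg_four_div a b hc hz).meromorphicAt.div
    (analyticAt_F_neg_four_div a (b + 1) hc.add_one hz).meromorphicAt).sub
      (MeromorphicAt.const 1 z))

/-- The change of variable has derivative 4/(z-2)² ≠ 0, so it preserves orders of vanishing. -/
theorem analyticOrderAt_F_neg_four_div_ne_top (a b : ℂ) {c : ℂ} (hc : Admissible c) {z : ℂ}
    (hz : z ∈ offInterval) : analyticOrderAt (fun z => F a b c (-4 / (z - 2))) z ≠ ⊤ := by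
  obtain ⟨h2, hw⟩ := neg_four_div_mem_slit hz
  have hd : HasDerivAt (fun z : ℂ => -4 / (z - 2)) (4 / (z - 2) ^ 2) z :=
    (((hasDerivAt_const z (-4 : ℂ)).fun_div ((hasDerivAt_id' z).sub_const 2) h2)).congr_deriv
      (by ring)
  have h := analyticOrderAt_comp_of_deriv_ne_zero (f := F a b c)
    (g := fun z : ℂ => -4 / (z - 2)) (z₀ := z)
    (analyticAt_const.div (analyticAt_id.sub analyticAt_const) h2)
    (by rw [hd.deriv]; exact div_ne_zero (by norm_num) (pow_ne_zero 2 h2))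
  rw [show (fun z => F a b c (-4 / (z - 2))) = F a b c ∘ fun z => -4 / (z - 2) from rfl, h]
  exact analyticOrderAt_F_ne_top a b hc hw

theorem isPole_B_iff {a b c : ℂ} (hc : Admissible c) (ha : a ≠ 0) (hbc : b ≠ c) {z : ℂ}
    (hz : z ∈ offInterval) :
    IsPole (B a b c) z ↔ F a (b + 1) (c + 1) (-4 / (z - 2)) = 0 := by
  obtain ⟨h2, hw⟩ := neg_four_div_mem_slit hz
  have hw0 : -4 / (z - 2) ≠ 0 := div_ne_zero (by norm_num) h2
  have hf := analyticAt_F_neg_four_div a b hc hz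
  have hg := analyticAt_F_neg_four_div a (b + 1) hc.add_one hz
  have hd : dOdd a b c 0 ≠ 0 := by
    simp only [dOdd, Nat.cast_zero, add_zero, mul_zero]
    exact div_ne_zero (mul_ne_zero ha (sub_ne_zero.2 hbc.symm))
      (mul_ne_zero hc.ne_zero hc.add_one.ne_zero)
  constructor
  · rintro ⟨-, h⟩
    by_contra hne
    refine h.not_ge (AnalyticAt.meromorphicOrderAt_nonneg ?_)
    exact analyticAt_const.mul ((hf.div hg hne).sub analyticAt_const)
  · intro h0
    refine ⟨meromorphicAt_B hc hz, ?_⟩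
    -- At a zero of the denominator the contiguous relation leaves -d₁ w F(a+1,b+1,c+2;w), all of
    -- whose factors are nonzero.
    have hf0 : F a b c (-4 / (z - 2)) ≠ 0 := by
      have h3 := F_add_one_ne_zero_of_F_eq_zero ha (b + 1) hc.add_one hw hw0 h0
      rw [show c + 1 + 1 = c + 2 by ring] at h3
      rw [F_eq_sub_dOdd a b hc hw, h0, zero_sub, neg_ne_zero]
      exact mul_ne_zero (mul_ne_zero hd hw0) h3
    have hg0 : Tendsto (fun z => F a (b + 1) (c + 1) (-4 / (z - 2))) (𝓝[≠] z) (𝓝[≠] 0) := by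
      refine tendsto_nhdsWithin_iff.2 ⟨?_, ?_⟩
      · have := hg.continuousAt.tendsto
        rw [h0] at this
        exact this.mono_left nhdsWithin_le_nhds
      · refine hg.eventually_eq_zero_or_eventually_ne_zero.resolve_left fun h4 => ?_
        exact analyticOrderAt_F_neg_four_div_ne_top a (b + 1) hc.add_one hz
          (analyticOrderAt_eq_top.2 h4)
    have hinv := tendsto_inv₀_nhdsNE_zero.comp hg0
    -- A pole means that |B| tends to infinity: the numerator has a nonzero limit while the
    -- denominator tends to 0 through nonzero values.
    rw [← tendsto_cobounded_iff_meromorphicOrderAt_neg (meromorphicAt_B hc hz)]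
    refine (tendsto_mul_left_cobounded (div_ne_zero (by norm_num)
      (mul_ne_zero (by norm_num) hd))).comp ((tendsto_sub_const_cobounded 1).comp ?_)
    rw [← tendsto_norm_atTop_iff_cobounded] at hinv ⊢
    have hlim : Tendsto (fun z => ‖F a b c (-4 / (z - 2))‖) (𝓝[≠] z)
        (𝓝 ‖F a b c (-4 / (z - 2))‖) :=
      hf.continuousAt.norm.tendsto.mono_left nhdsWithin_le_nhds
    refine (hlim.pos_mul_atTop (norm_pos_iff.2 hf0) hinv).congr fun y => ?_
    rw [← norm_mul, div_eq_mul_inv]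
    rfl

end

end HypJacobi

theorem mainTheorem2 (a b c : ℂ) (hc : ∀ m : ℕ, c ≠ -(m : ℂ)) (ha : a ≠ 0) (hbc : b ≠ c)
    (β : ℕ → ℂ) (hβ : ∀ k, β k ^ 2 = HypJacobi.offDiagSq a b c k) :
    MeromorphicOn (HypJacobi.B a b c) HypJacobi.offInterval ∧
      ∀ z ∈ HypJacobi.offInterval,
        (HypJacobi.IsPole (HypJacobi.B a b c) z ↔
          Module.End.HasEigenvalue
            (HypJacobi.J a b c β hβ : HypJacobi.ell2 →ₗ[ℂ] HypJacobi.ell2) z) := by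
  refine ⟨fun z hz => HypJacobi.meromorphicAt_B hc hz, fun z hz => ?_⟩
  obtain ⟨h2, hw⟩ := HypJacobi.neg_four_div_mem_slit hz
  have hw0 : -4 / (z - 2) ≠ 0 := div_ne_zero (by norm_num) h2
  have hz' : 2 - 4 / (-4 / (z - 2)) = z := by field_simp; ring
  rw [HypJacobi.isPole_B_iff hc ha hbc hz]
  constructor
  · intro h
    have := HypJacobi.hasEigenvalue_J_of_F_eq_zero hc ha hβ hw hw0 h
    rwa [hz'] at this
  · intro h
    refine HypJacobi.F_eq_zero_of_hasEigenvalue_J hc hβ hw hw0 ?_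
    rwa [hz']
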